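/- For $B\in O(8)$ and $b\in\mathbb R^8$ let $BL_b$ denote the isometry $x\mapsto B(x+b)$ of $\mathbb R^8$. Let $e_1,\dots,e_8$ be the canonical basis, $\Lambda=\mathbb Z^8$, $\tilde J=\begin{pmatrix}0&1\\-1&0\end{pmatrix}$, and let $$B_1=\mathrm{diag}(\tilde J,\tilde J,1,1,-1,-1),\qquad B_2=\mathrm{diag}(-1,-1,1,1,1,1,1,1),$$ $$B_1'=\mathrm{diag}(\tilde J,1,-1,-1,1,-1,1),\qquad B_2'=\mathrm{diag}(-1,-1,-1,1,-1,1,1,1)$$ (block diagonal $8\times 8$ matrices). Consider the groups of isometries $$\Gamma=\langle B_1L_{e_5/4},\;B_2L_{e_6/2},\;L_\lambda:\lambda\in\Lambda\rangle,\qquad \Gamma'=\langle B_1'L_{e_6/4},\;B_2'L_{(e_4+e_5)/2},\;L_\lambda:\lambda\in\Lambda\rangle .$$ Then: 1. $\Gamma$ and $\Gamma'$ are Bieberbach groups, i.e. discrete, cocompact, torsion-free subgroups of the isometry group of $\mathbb R^8$, so that $M_\Gamma=\Gamma\backslash\mathbb R^8$ and $M_{\Gamma'}=\Gamma'\backslash\mathbb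 R^8$, with the metrics induced from $\mathbb R^8$, are compact flat Riemannian manifolds of dimension $8$. 2. The linear holonomy groups of $M_\Gamma$ and $M_{\Gamma'}$, i.e. the groups of linear parts of the elements of $\Gamma$ and of $\Gamma'$, are both isomorphic to $\mathbb Z_4\times\mathbb Z_2$. 3. $M_\Gamma$ is orientable and $M_{\Gamma'}$ is not orientable. 4. For every integer $0\le p\le 8$, $M_\Gamma$ and $M_{\Gamma'}$ are isospectral on $p$-forms (that is, the Hodge Laplacians $d\delta+\delta d$ acting on smooth $p$-forms on $M_\Gamma$ and $M_{\Gamma'}$ have the same eigenvalues with the same multiplicities) if and only if $p$ is odd. -/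

import Mathlib

open scoped ContDiff Matrix

noncomputable section

namespace FlatForms

/-- Euclidean space `ℝⁿ`. -/
abbrev E (n : ℕ) : Type := EuclideanSpace ℝ (Fin n)

/-- The isometry group `I(ℝⁿ)` (every isometry of `ℝⁿ` is affine). -/
abbrev Iso (n : ℕ) : Type := E n ≃ᵃⁱ[ℝ] E n

/-! ### Bieberbach groups and their quotients -/

/-- The projection `I(ℝⁿ) → O(n)`, sending an isometry to its linear part. -/
def linearPart (n : ℕ) : Iso n →* (E n ≃ₗᵢ[ℝ] E n) where
  toFun g := g.linearIsometryEquiv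
  map_one' := by ext v; rfl
  map_mul' g h := by ext v; rfl

/-- The orbit relation of `Γ` on `ℝⁿ`. -/
def orbitSetoid {n : ℕ} (Γ : Subgroup (Iso n)) : Setoid (E n) where
  r x y := ∃ g ∈ Γ, g x = y
  iseqv :=
    { refl := fun x => ⟨1, Γ.one_mem, rfl⟩
      symm := by
        rintro x y ⟨g, hg, rfl⟩
        exact ⟨g⁻¹, Γ.inv_mem hg, g.symm_apply_apply x⟩
      trans := by
        rintro x y z ⟨g, hg, rfl⟩ ⟨h, hh, rfl⟩
        exact ⟨h * g, Γ.mul_mem hh hg, rfl⟩ }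

/-- The quotient `M_Γ = Γ \ ℝⁿ`, with the quotient topology. -/
abbrev FlatQuotient {n : ℕ} (Γ : Subgroup (Iso n)) : Type := Quotient (orbitSetoid Γ)

/-- An isometry regarded as an element of `C(ℝⁿ, ℝⁿ)`; the topology of `I(ℝⁿ)` is the one
induced by the compact-open topology. -/
def toContMap {n : ℕ} (g : Iso n) : C(E n, E n) := ⟨g, g.continuous⟩

/-- A Bieberbach group: a discrete, cocompact, torsion-free subgroup of `I(ℝⁿ)`.
Then `Γ \ ℝⁿ` is a compact flat Riemannian manifold with the metric induced from `ℝⁿ`. -/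
structure IsBieberbach {n : ℕ} (Γ : Subgroup (Iso n)) : Prop where
  discrete : DiscreteTopology ↥(toContMap '' (Γ : Set (Iso n)))
  cocompact : CompactSpace (FlatQuotient Γ)
  torsionFree : ∀ g ∈ Γ, ∀ k : ℕ, 0 < k → g ^ k = 1 → g = 1

/-- The (linear) holonomy group of `Γ \ ℝⁿ`. Parallel transport in `ℝⁿ` is trivial, so parallel
transport along the loop of `Γ \ ℝⁿ` that lifts to a path from `x` to `γ x` is given by the linear
part of `γ` (or its inverse): the holonomy group consists of the linear parts of elements
of `Γ`. -/
def holonomy {n : ℕ} (Γ : Subgroup (Iso n)) : Subgroup (E n ≃ₗᵢ[ℝ] E n) :=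
  Γ.map (linearPart n)

/-! ### Differential forms on `Γ \ ℝⁿ` and the Hodge Laplacian -/

/-- Differential `p`-forms on `ℝⁿ` with values in `F` (`F = ℝ` or `F = ℂ`). -/
abbrev Form (n p : ℕ) (F : Type) [NormedAddCommGroup F] [NormedSpace ℝ F] : Type :=
  E n → E n [⋀^Fin p]→L[ℝ] F

section Forms

variable {n p : ℕ} {F : Type} [NormedAddCommGroup F] [NormedSpace ℝ F]

/-- The pull-back `γ^* α` by an isometry. -/
def pullback (g : Iso n) (α : Form n p F) : Form n p F := fun x =>
  (α (g x)).compContinuousLinearMap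
    (g.linearIsometryEquiv.toContinuousLinearEquiv : E n →L[ℝ] E n)

/-- `α` is a smooth `p`-form on `Γ \ ℝⁿ`, that is, a smooth form on `ℝⁿ` with `γ^* α = α` for
all `γ ∈ Γ`. -/
structure IsFormOn (Γ : Subgroup (Iso n)) (α : Form n p F) : Prop where
  smooth : ContDiff ℝ ∞ α
  invariant : ∀ g ∈ Γ, pullback g α = α

/-- The codifferential `δ : Ω^{p+1} → Ω^p` of the flat metric,
`(δα)(v₁,…,v_p) = - ∑ᵢ (∇_{eᵢ} α)(eᵢ, v₁,…,v_p)`, the formal adjoint of the exterior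
derivative. -/
def codiff (α : Form n (p + 1) F) : Form n p F := fun x =>
  -∑ i : Fin n, (fderiv ℝ α x (EuclideanSpace.single i 1)).curryLeft (EuclideanSpace.single i 1)

/-- The (nonnegative) Hodge Laplacian `dδ + δd` on `p`-forms; `δ = 0` on functions. -/
def hodgeLaplacian : {p : ℕ} → Form n p F → Form n p F
  | 0, α => codiff (extDeriv α)
  | _ + 1, α => extDeriv (codiff α) + codiff (extDeriv α)

end Forms

section Linearity

variable {n p : ℕ}

theorem fderiv_csmul {G : Type} [NormedAddCommGroup G] [NormedSpace ℝ G] [NormedSpace ℂ G]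
    [IsScalarTower ℝ ℂ G] {α : E n → G} (h : Differentiable ℝ α) (c : ℂ) (x : E n) :
    fderiv ℝ (c • α) x = c • fderiv ℝ α x :=
  fderiv_const_smul (h x) c

theorem extDeriv_csmul {α : Form n p ℂ} (h : Differentiable ℝ α) (c : ℂ) :
    extDeriv (c • α) = c • extDeriv α := by
  ext x v
  simp only [extDeriv, Pi.smul_apply, ContinuousAlternatingMap.alternatizeUncurryFin_apply,
    fderiv_csmul h c x, _root_.smul_apply, ContinuousAlternatingMap.smul_apply,
    Finset.smul_sum]
  exact Finset.sum_congr rfl fun i _ => smul_comm _ _ _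

theorem extDeriv_add' {α β : Form n p ℂ} (h : Differentiable ℝ α) (k : Differentiable ℝ β) :
    extDeriv (α + β) = extDeriv α + extDeriv β :=
  funext fun x => extDeriv_add (h x) (k x)

theorem codiff_csmul {α : Form n (p + 1) ℂ} (h : Differentiable ℝ α) (c : ℂ) :
    codiff (c • α) = c • codiff α := by
  ext x v
  simp [codiff, fderiv_csmul h c x, Finset.mul_sum]

theorem codiff_add {α β : Form n (p + 1) ℂ} (h : Differentiable ℝ α)
    (k : Differentiable ℝ β) : codiff (α + β) = codiff α + codiff β := by
  ext x v
  simp [codiff, fderiv_add (h x) (k x), Finset.sum_add_distrib]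
  ring

theorem contDiff_extDeriv {α : Form n p ℂ} (h : ContDiff ℝ ∞ α) :
    ContDiff ℝ ∞ (extDeriv α) := by
  have h1 : ContDiff ℝ ∞ (fderiv ℝ α) := h.fderiv_right (by simp)
  exact (ContinuousAlternatingMap.alternatizeUncurryFinCLM ℝ (E n) ℂ).contDiff.comp h1

theorem contDiff_codiff {α : Form n (p + 1) ℂ} (h : ContDiff ℝ ∞ α) :
    ContDiff ℝ ∞ (codiff α) := by
  refine ContDiff.neg (ContDiff.sum fun i _ => ?_)
  have h1 : ContDiff ℝ ∞ fun x => fderiv ℝ α x (EuclideanSpace.single i 1) :=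
    (h.fderiv_right (m := ∞) (by simp)).clm_apply contDiff_const
  exact ((ContinuousAlternatingMap.curryLeftLI (𝕜 := ℝ) (E := E n) (F := ℂ)
    (n := p)).contDiff.comp h1).clm_apply contDiff_const

theorem hodgeLaplacian_add : ∀ {p : ℕ} {α β : Form n p ℂ}, ContDiff ℝ ∞ α → ContDiff ℝ ∞ β →
    hodgeLaplacian (α + β) = hodgeLaplacian α + hodgeLaplacian β
  | 0, α, β, h, k => by
    have d : ∀ {m : ℕ} {ξ : Form n m ℂ}, ContDiff ℝ ∞ ξ → Differentiable ℝ ξ :=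
      fun H => H.differentiable (by simp)
    simp only [hodgeLaplacian]
    rw [extDeriv_add' (d h) (d k),
      codiff_add (d (contDiff_extDeriv h)) (d (contDiff_extDeriv k))]
  | p + 1, α, β, h, k => by
    have d : ∀ {m : ℕ} {ξ : Form n m ℂ}, ContDiff ℝ ∞ ξ → Differentiable ℝ ξ :=
      fun H => H.differentiable (by simp)
    simp only [hodgeLaplacian]
    rw [extDeriv_add' (d h) (d k),
      codiff_add (d (contDiff_extDeriv h)) (d (contDiff_extDeriv k)), codiff_add (d h) (d k),
      extDeriv_add' (d (contDiff_codiff h)) (d (contDiff_codiff k)), add_add_add_comm]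

theorem hodgeLaplacian_csmul : ∀ {p : ℕ} {α : Form n p ℂ} (c : ℂ), ContDiff ℝ ∞ α →
    hodgeLaplacian (c • α) = c • hodgeLaplacian α
  | 0, α, c, h => by
    have d : ∀ {m : ℕ} {ξ : Form n m ℂ}, ContDiff ℝ ∞ ξ → Differentiable ℝ ξ :=
      fun H => H.differentiable (by simp)
    simp only [hodgeLaplacian]
    rw [extDeriv_csmul (d h), codiff_csmul (d (contDiff_extDeriv h))]
  | p + 1, α, c, h => by
    have d : ∀ {m : ℕ} {ξ : Form n m ℂ}, ContDiff ℝ ∞ ξ → Differentiable ℝ ξ :=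
      fun H => H.differentiable (by simp)
    simp only [hodgeLaplacian]
    rw [extDeriv_csmul (d h), codiff_csmul (d (contDiff_extDeriv h)), codiff_csmul (d h),
      extDeriv_csmul (d (contDiff_codiff h)), smul_add]

end Linearity

/-- The eigenspace `{α : Δ_p α = μ α}` of the Hodge Laplacian on smooth complex-valued `p`-forms
on `Γ \ ℝⁿ`. -/
def eigenspace {n : ℕ} (Γ : Subgroup (Iso n)) (p : ℕ) (μ : ℝ) : Submodule ℂ (Form n p ℂ) where
  carrier := {α | IsFormOn Γ α ∧ hodgeLaplacian α = (μ : ℂ) • α}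
  zero_mem' := by
    have h : ContDiff ℝ ∞ (0 : Form n p ℂ) := contDiff_const
    refine ⟨⟨h, fun g _ => rfl⟩, ?_⟩
    have := hodgeLaplacian_csmul 0 h
    rw [zero_smul, zero_smul] at this
    rw [this, smul_zero]
  add_mem' := by
    rintro α β ⟨⟨h, i⟩, e⟩ ⟨⟨k, j⟩, f⟩
    refine ⟨⟨h.add k, fun g hg => ?_⟩, ?_⟩
    · conv_rhs => rw [← i g hg, ← j g hg]
      rfl
    · rw [hodgeLaplacian_add h k, e, f, smul_add]
  smul_mem' := by
    rintro c α ⟨⟨h, i⟩, e⟩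
    refine ⟨⟨h.const_smul c, fun g hg => ?_⟩, ?_⟩
    · conv_rhs => rw [← i g hg]
      rfl
    · rw [hodgeLaplacian_csmul c h, e, smul_comm]

/-- `Γ \ ℝⁿ` and `Γ' \ ℝⁿ` are isospectral on `p`-forms: every real number is an eigenvalue of
the Hodge Laplacians on `p`-forms with the same multiplicity (`0` if it is not an eigenvalue). -/
def Isospectral {n : ℕ} (Γ Γ' : Subgroup (Iso n)) (p : ℕ) : Prop :=
  ∀ μ : ℝ, Module.rank ℂ (eigenspace Γ p μ) = Module.rank ℂ (eigenspace Γ' p μ)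

/-- `Γ \ ℝⁿ` is orientable: it carries a nowhere vanishing smooth real `n`-form. -/
def IsOrientable {n : ℕ} (Γ : Subgroup (Iso n)) : Prop :=
  ∃ α : Form n n ℝ, IsFormOn Γ α ∧ ∀ x, α x ≠ 0

/-! ### The two groups -/

/-- The linear isometry `x ↦ B x` (column vectors) given by an integral orthogonal matrix. -/
def matrixIso {n : ℕ} (B : Matrix (Fin n) (Fin n) ℤ) (hB : B * Bᵀ = 1) : E n ≃ₗᵢ[ℝ] E n where
  toFun x := WithLp.toLp 2 (B.map (Int.cast : ℤ → ℝ) *ᵥ x.ofLp)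
  invFun x := WithLp.toLp 2 (Bᵀ.map (Int.cast : ℤ → ℝ) *ᵥ x.ofLp)
  map_add' x y := by simp [Matrix.mulVec_add]
  map_smul' c x := by simp [Matrix.mulVec_smul]
  left_inv x := by
    have h : Bᵀ.map (Int.cast : ℤ → ℝ) * B.map (Int.cast : ℤ → ℝ) = 1 := by
      have := congrArg (Int.castRingHom ℝ).mapMatrix (mul_eq_one_comm.mp hB)
      simpa [Matrix.map_mul_intCast] using this
    simp [Matrix.mulVec_mulVec, h]
  right_inv x := by
    have h : B.map (Int.cast : ℤ → ℝ) * Bᵀ.map (Int.cast : ℤ → ℝ) = 1 := by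
      have := congrArg (Int.castRingHom ℝ).mapMatrix hB
      simpa [Matrix.map_mul_intCast] using this
    simp [Matrix.mulVec_mulVec, h]
  norm_map' x := by
    have h : (B.map (Int.cast : ℤ → ℝ))ᵀ * B.map (Int.cast : ℤ → ℝ) = 1 := by
      have := congrArg (Int.castRingHom ℝ).mapMatrix (mul_eq_one_comm.mp hB)
      simpa [Matrix.map_mul_intCast, Matrix.transpose_map] using this
    have h2 : ∀ y : E n, ‖y‖ ^ 2 = y.ofLp ⬝ᵥ y.ofLp := fun y => by
      rw [EuclideanSpace.norm_sq_eq]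
      simp [dotProduct, sq]
    have h3 : ∀ y : Fin n → ℝ, (B.map (Int.cast : ℤ → ℝ) *ᵥ y) ⬝ᵥ
        (B.map (Int.cast : ℤ → ℝ) *ᵥ y) = y ⬝ᵥ y := fun y => by
      rw [Matrix.dotProduct_mulVec, Matrix.vecMul_mulVec, h, Matrix.vecMul_one]
    rw [← sq_eq_sq₀ (norm_nonneg _) (norm_nonneg _), h2, h2]
    exact h3 _

/-- The translation `L_b : x ↦ x + b`. -/
def transl {n : ℕ} (b : E n) : Iso n := AffineIsometryEquiv.constVAdd ℝ (E n) b

/-- The isometry `B L_b : x ↦ B (x + b)`. -/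
def rotTrans {n : ℕ} (B : Matrix (Fin n) (Fin n) ℤ) (hB : B * Bᵀ = 1) (b : E n) : Iso n :=
  (matrixIso B hB).toAffineIsometryEquiv * transl b

/-- The translations by the canonical lattice `ℤⁿ`. -/
def latticeTranslations (n : ℕ) : Set (Iso n) :=
  {g | ∃ m : Fin n → ℤ, g = transl (WithLp.toLp 2 fun i => (m i : ℝ))}

def B₁ : Matrix (Fin 8) (Fin 8) ℤ :=
  !![ 0, 1,  0, 0,  0, 0,  0,  0;
     -1, 0,  0, 0,  0, 0,  0,  0;
      0, 0,  0, 1,  0, 0,  0,  0;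
      0, 0, -1, 0,  0, 0,  0,  0;
      0, 0,  0, 0,  1, 0,  0,  0;
      0, 0,  0, 0,  0, 1,  0,  0;
      0, 0,  0, 0,  0, 0, -1,  0;
      0, 0,  0, 0,  0, 0,  0, -1]

def B₂ : Matrix (Fin 8) (Fin 8) ℤ := Matrix.diagonal ![-1, -1, 1, 1, 1, 1, 1, 1]

def B₁' : Matrix (Fin 8) (Fin 8) ℤ :=
  !![ 0, 1,  0,  0,  0, 0,  0, 0;
     -1, 0,  0,  0,  0, 0,  0, 0;
      0, 0,  1,  0,  0, 0,  0, 0;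
      0, 0,  0, -1,  0, 0,  0, 0;
      0, 0,  0,  0, -1, 0,  0, 0;
      0, 0,  0,  0,  0, 1,  0, 0;
      0, 0,  0,  0,  0, 0, -1, 0;
      0, 0,  0,  0,  0, 0,  0, 1]

def B₂' : Matrix (Fin 8) (Fin 8) ℤ := Matrix.diagonal ![-1, -1, -1, 1, -1, 1, 1, 1]

theorem hB₁ : B₁ * B₁ᵀ = 1 := by decide +kernel
theorem hB₂ : B₂ * B₂ᵀ = 1 := by decide +kernel
theorem hB₁' : B₁' * B₁'ᵀ = 1 := by decide +kernel
theorem hB₂' : B₂' * B₂'ᵀ = 1 := by decide +kernel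

/-- The standard basis vectors `e₁, …, e₈` of `ℝ⁸` (`e i` is `e_{i+1}`). -/
def e (i : Fin 8) : E 8 := EuclideanSpace.single i 1

/-- `Γ = ⟨B₁ L_{e₅/4}, B₂ L_{e₆/2}, L_λ : λ ∈ ℤ⁸⟩`. -/
def Γ₈ : Subgroup (Iso 8) :=
  Subgroup.closure
    ({rotTrans B₁ hB₁ ((1 / 4 : ℝ) • e 4), rotTrans B₂ hB₂ ((1 / 2 : ℝ) • e 5)} ∪
      latticeTranslations 8)

/-- `Γ' = ⟨B₁' L_{e₆/4}, B₂' L_{(e₄+e₅)/2}, L_λ : λ ∈ ℤ⁸⟩`. -/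
def Γ₈' : Subgroup (Iso 8) :=
  Subgroup.closure
    ({rotTrans B₁' hB₁' ((1 / 4 : ℝ) • e 5),
      rotTrans B₂' hB₂' ((1 / 2 : ℝ) • (e 3 + e 4))} ∪ latticeTranslations 8)

end FlatForms

end

/-!
The groups `Γ` and `Γ'` are preimages in `I(ℝ⁸)` of finite groups of isometries modulo the lattice
`ℤ⁸`, both isomorphic to `ℤ₄ × ℤ₂`. An isometry `x ↦ B (x + b)` with `4b` integral is recorded
modulo `ℤ⁸` by the pair of `B` and `4b mod 4`; these pairs form a group `QuarterIso`, in which every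
relation between the generators is a finite computation. The Bieberbach properties, the holonomy and
the orientability are read off from the pairs (`isBieberbach_crystalGroup`,
`nonempty_holonomy_mulEquiv`, `isOrientable_crystalGroup`, `not_isOrientable_crystalGroup`). In
particular the groups are torsion-free because every nontrivial element of the point group
translates some coordinate by a nonzero amount modulo `1`.

For the spectra, the Hodge Laplacian of the flat metric acts on coefficients
(`hodgeLaplacian_eq_flatLaplacian`), and a smooth periodic eigenfunction with eigenvalue `μ` is a
trigonometric polynomial with frequencies in the finite set of lattice vectors `m` with
`4π²|m|² = μ` (`exists_synthesis_eq`). Hence an eigenspace on `Γ \ ℝ⁸` is the space of invariants of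
the point group on the coefficients (`eigenspace_eq_map`), and its dimension is the average of the
traces of the point group. The trace of the class of `x ↦ B (x + b)` is the product of
`∑ exp (2πi ⟨m, b⟩)`, over the frequencies `m` fixed by `B`, and of the trace of `B` on `Λᵖ`
(`trace_coeffPull`).

The elements of the two point groups whose linear part has order at most two match in pairs up to
conjugation, so that only the eight elements with linear part of order four matter
(`isospectral_Γ₈_iff`). Their linear parts are conjugate to their negatives, so that their traces on
`Λᵖ` vanish for odd `p`. For even `p > 0` the harmonic forms distinguish the quotients: the trace on
`Λᵖ` is a coefficient of `det (1 + X B)` (`extTrace_eq_coeff`), which is `1 - 2X⁴ + X⁸` for the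
elements of order four of `Γ`, and `1 - 2X² + 2X⁶ - X⁸` for those of `Γ'`. For `p = 0` the
multiplicities of the eigenvalue `4π²`, with frequencies `± eᵢ`, differ.
-/

noncomputable section

namespace FlatForms

/-! ### The Hodge Laplacian of the flat metric acts coefficientwise -/

section Weitzenbock

variable {n p : ℕ} {F : Type} [NormedAddCommGroup F] [NormedSpace ℝ F]

/-- The (nonnegative) Laplacian `-∑ᵢ ∂ᵢ²` of a vector-valued function on `ℝⁿ`. -/
def flatLaplacian (h : E n → F) : E n → F := fun x =>
  -∑ i : Fin n, fderiv ℝ (fderiv ℝ h) x (EuclideanSpace.single i 1) (EuclideanSpace.single i 1)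

theorem flatLaplacian_add {f g : E n → F} (hf : ContDiff ℝ ∞ f) (hg : ContDiff ℝ ∞ g) :
    flatLaplacian (f + g) = flatLaplacian f + flatLaplacian g := by
  funext x
  have hd : ∀ {f : E n → F}, ContDiff ℝ ∞ f → Differentiable ℝ f :=
    fun h => h.differentiable (by simp)
  have hd2 : ∀ {f : E n → F}, ContDiff ℝ ∞ f → Differentiable ℝ (fderiv ℝ f) :=
    fun h => (h.fderiv_right (m := ∞) (by simp)).differentiable (by simp)
  have h1 : fderiv ℝ (f + g) = fderiv ℝ f + fderiv ℝ g :=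
    funext fun y => fderiv_add (hd hf y) (hd hg y)
  simp only [flatLaplacian, h1, Pi.add_apply, fderiv_add (hd2 hf x) (hd2 hg x),
    _root_.add_apply, Finset.sum_add_distrib, neg_add]

theorem flatLaplacian_zero : flatLaplacian (0 : E n → F) = 0 := by
  have h : fderiv ℝ (0 : E n → F) = 0 := funext fun x => fderiv_const_apply (0 : F)
  have h' : fderiv ℝ (0 : E n → E n →L[ℝ] F) = 0 :=
    funext fun x => fderiv_const_apply (0 : E n →L[ℝ] F)
  funext x
  simp [flatLaplacian, h, h']

theorem fderiv_extDeriv {α : Form n p F} (h : ContDiff ℝ ∞ α) (x u : E n) :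
    fderiv ℝ (extDeriv α) x u =
      ContinuousAlternatingMap.alternatizeUncurryFin (fderiv ℝ (fderiv ℝ α) x u) := by
  have h1 : ContDiff ℝ ∞ (fderiv ℝ α) := h.fderiv_right (by simp)
  have h2 : DifferentiableAt ℝ (fderiv ℝ α) x := h1.differentiable (by simp) x
  let A : (E n →L[ℝ] E n [⋀^Fin p]→L[ℝ] F) →L[ℝ] (E n [⋀^Fin (p + 1)]→L[ℝ] F) :=
    ContinuousAlternatingMap.alternatizeUncurryFinCLM ℝ (E n) F
  have e : extDeriv α = A ∘ fderiv ℝ α := rfl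
  rw [e, (A.hasFDerivAt.comp x h2.hasFDerivAt).fderiv]
  rfl

theorem fderiv_codiff {α : Form n (p + 1) F} (h : ContDiff ℝ ∞ α) (x u : E n) :
    fderiv ℝ (codiff α) x u =
      -∑ i : Fin n, (fderiv ℝ (fderiv ℝ α) x u (EuclideanSpace.single i 1)).curryLeft
        (EuclideanSpace.single i 1) := by
  have h1 : ContDiff ℝ ∞ (fderiv ℝ α) := h.fderiv_right (by simp)
  have h2 : DifferentiableAt ℝ (fderiv ℝ α) x := h1.differentiable (by simp) x
  let C : (E n [⋀^Fin (p + 1)]→L[ℝ] F) →L[ℝ] (E n →L[ℝ] E n [⋀^Fin p]→L[ℝ] F) :=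
    (ContinuousAlternatingMap.curryLeftLI (𝕜 := ℝ) (E := E n) (F := F)
      (n := p)).toContinuousLinearMap
  let A : (E n →L[ℝ] E n [⋀^Fin (p + 1)]→L[ℝ] F) →L[ℝ] (E n [⋀^Fin p]→L[ℝ] F) :=
    -∑ i : Fin n, (ContinuousLinearMap.apply ℝ _ (EuclideanSpace.single i 1 : E n)) ∘L C ∘L
      (ContinuousLinearMap.apply ℝ _ (EuclideanSpace.single i 1 : E n))
  have hA : ∀ T, A T = -∑ i : Fin n, (T (EuclideanSpace.single i 1)).curryLeft
      (EuclideanSpace.single i 1) := fun T => by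
    simp [A, C]
  have e : codiff α = A ∘ fderiv ℝ α := by
    funext y
    exact (hA _).symm
  rw [e, (A.hasFDerivAt.comp x h2.hasFDerivAt).fderiv, ContinuousLinearMap.comp_apply, hA]

/-- The Weitzenböck formula of the flat metric: the cross terms of `dδ` and `δd` cancel because
second derivatives commute. -/
theorem hodgeLaplacian_eq_flatLaplacian : ∀ {p : ℕ} {α : Form n p F}, ContDiff ℝ ∞ α →
    hodgeLaplacian α = flatLaplacian α
  | 0, α, h => by
    funext x
    ext v
    simp only [hodgeLaplacian, codiff, flatLaplacian, fderiv_extDeriv h]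
    simp [ContinuousAlternatingMap.alternatizeUncurryFin_apply]
  | p + 1, α, h => by
    funext x
    ext v
    have hs : ∀ u w, fderiv ℝ (fderiv ℝ α) x u w = fderiv ℝ (fderiv ℝ α) x w u := fun u w =>
      (h.contDiffAt (x := x)).isSymmSndFDerivAt
        (by simpa using WithTop.coe_le_coe.2 (le_top : (2 : ℕ∞) ≤ ⊤)) u w
    have h1 : extDeriv (codiff α) x v = -∑ i : Fin n, ∑ j : Fin (p + 1), (-1) ^ (j : ℕ) •
        fderiv ℝ (fderiv ℝ α) x (v j) (EuclideanSpace.single i 1)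
          (Matrix.vecCons (EuclideanSpace.single i 1) (j.removeNth v)) := by
      rw [extDeriv, ContinuousAlternatingMap.alternatizeUncurryFin_apply]
      simp only [fderiv_codiff h]
      rw [Finset.sum_comm, ← Finset.sum_neg_distrib]
      refine Finset.sum_congr rfl fun j _ => ?_
      simp [Finset.smul_sum, ContinuousAlternatingMap.sum_apply]
    have h2 : codiff (extDeriv α) x v = -∑ i : Fin n,
        (fderiv ℝ (fderiv ℝ α) x (EuclideanSpace.single i 1) (EuclideanSpace.single i 1) v -
        ∑ j : Fin (p + 1), (-1) ^ (j : ℕ) •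
        fderiv ℝ (fderiv ℝ α) x (EuclideanSpace.single i 1) (v j)
          (Matrix.vecCons (EuclideanSpace.single i 1) (j.removeNth v))) := by
      simp only [codiff, fderiv_extDeriv h]
      rw [ContinuousAlternatingMap.neg_apply, ContinuousAlternatingMap.sum_apply]
      congr 1
      refine Finset.sum_congr rfl fun i _ => ?_
      rw [ContinuousAlternatingMap.curryLeft_apply_apply,
        ContinuousAlternatingMap.alternatizeUncurryFin_apply, Fin.sum_univ_succ, sub_eq_add_neg,
        ← Finset.sum_neg_distrib]
      congr 1
      · simp [Fin.removeNth_zero, Matrix.vecCons]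
      · refine Finset.sum_congr rfl fun j _ => ?_
        have : (j.succ).removeNth (Matrix.vecCons (EuclideanSpace.single i 1) v) =
            Matrix.vecCons (EuclideanSpace.single i (1 : ℝ)) (j.removeNth v) := by
          funext k
          refine Fin.cases ?_ (fun k => ?_) k <;> simp [Fin.removeNth, Matrix.vecCons]
        rw [this]
        simp [pow_succ]
    change extDeriv (codiff α) x v + codiff (extDeriv α) x v = _
    rw [h1, h2, flatLaplacian, ContinuousAlternatingMap.neg_apply,
      ContinuousAlternatingMap.sum_apply, ← neg_add, ← Finset.sum_add_distrib]
    congr 1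
    refine Finset.sum_congr rfl fun i _ => ?_
    simp only [hs _ (EuclideanSpace.single i 1)]
    abel

end Weitzenbock

/-! ### Fourier series of periodic eigenfunctions -/

section Fourier

open MeasureTheory UnitAddTorus

/-- The normalised Haar measure, which is the one used by `UnitAddTorus.mFourierCoeff`. -/
local instance : MeasureSpace UnitAddCircle := ⟨AddCircle.haarAddCircle⟩

local instance : Measure.IsAddHaarMeasure (volume : Measure UnitAddCircle) :=
  inferInstanceAs (Measure.IsAddHaarMeasure AddCircle.haarAddCircle)

local instance : IsProbabilityMeasure (volume : Measure UnitAddCircle) :=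
  inferInstanceAs (IsProbabilityMeasure AddCircle.haarAddCircle)

variable {n : ℕ} {F : Type} [NormedAddCommGroup F] [NormedSpace ℝ F]

/-- The vector of `ℝⁿ` with the given integral coordinates. -/
def intVec (m : Fin n → ℤ) : E n := WithLp.toLp 2 fun i => (m i : ℝ)

/-- `ℤⁿ`-periodicity. -/
def IsPeriodic {G : Type} (f : E n → G) : Prop :=
  ∀ (m : Fin n → ℤ) (x : E n), f (x + intVec m) = f x

/-- The projection `ℝⁿ → ℝⁿ/ℤⁿ`. -/
def torusProj (x : E n) : UnitAddTorus (Fin n) := fun i => (x i : UnitAddCircle)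

theorem torusProj_add (x y : E n) : torusProj (x + y) = torusProj x + torusProj y := by
  funext i
  simp [torusProj]

theorem isOpenQuotientMap_torusProj : IsOpenQuotientMap (torusProj (n := n)) := by
  have h : IsOpenQuotientMap (Pi.map fun (_ : Fin n) (x : ℝ) => (x : UnitAddCircle)) :=
    IsOpenQuotientMap.piMap fun _ => QuotientAddGroup.isOpenQuotientMap_mk
  exact h.comp (PiLp.homeomorph 2 fun _ : Fin n => ℝ).isOpenQuotientMap

theorem exists_intVec_of_torusProj_eq {x y : E n} (h : torusProj x = torusProj y) :
    ∃ m, y = x + intVec m := by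
  have h1 : ∀ i, ∃ k : ℤ, (k : ℝ) = y i - x i := fun i => by
    have h2 : ((y i - x i : ℝ) : UnitAddCircle) = 0 := by
      rw [AddCircle.coe_sub]
      exact sub_eq_zero.2 (congrFun h i).symm
    obtain ⟨k, hk⟩ := (AddCircle.coe_eq_zero_iff _).1 h2
    exact ⟨k, by simpa using hk⟩
  choose m hm using h1
  refine ⟨m, ?_⟩
  ext i
  simp [intVec, hm]

theorem exists_torus_lift {f : E n → ℂ} (hf : Continuous f) (hp : IsPeriodic f) :
    ∃ g : C(UnitAddTorus (Fin n), ℂ), ∀ x, g (torusProj x) = f x := by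
  have hq := (isOpenQuotientMap_torusProj (n := n)).isQuotientMap
  let q : C(E n, UnitAddTorus (Fin n)) := ⟨torusProj, hq.continuous⟩
  have hq' : Topology.IsQuotientMap q := hq
  have hfac : Function.FactorsThrough (⟨f, hf⟩ : C(E n, ℂ)) q := fun x y h => by
    obtain ⟨m, rfl⟩ := exists_intVec_of_torusProj_eq h
    exact (hp m x).symm
  exact ⟨hq'.lift ⟨f, hf⟩ hfac, fun x => DFunLike.congr_fun (hq'.lift_comp ⟨f, hf⟩ hfac) x⟩

/-- The plane wave `x ↦ exp (2πi ⟨m, x⟩)`. -/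
def planeWave (m : Fin n → ℤ) (x : E n) : ℂ :=
  Complex.exp (2 * Real.pi * Complex.I * ∑ i, (m i : ℂ) * (x i : ℂ))

theorem mFourier_torusProj (m : Fin n → ℤ) (x : E n) :
    mFourier m (torusProj x) = planeWave m x := by
  simp only [mFourier, torusProj, planeWave, ContinuousMap.coe_mk, fourier_coe_apply,
    ← Complex.exp_sum, Finset.mul_sum]
  congr 1
  refine Finset.sum_congr rfl fun i _ => ?_
  simp
  ring

theorem planeWave_add (m : Fin n → ℤ) (x y : E n) :
    planeWave m (x + y) = planeWave m x * planeWave m y := by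
  simp only [planeWave, ← Complex.exp_add, ← mul_add, ← Finset.sum_add_distrib]
  simp

theorem mFourier_apply_add (m : Fin n → ℤ) (x y : UnitAddTorus (Fin n)) :
    mFourier m (x + y) = mFourier m x * mFourier m y := by
  obtain ⟨x, rfl⟩ := isOpenQuotientMap_torusProj.surjective x
  obtain ⟨y, rfl⟩ := isOpenQuotientMap_torusProj.surjective y
  rw [← torusProj_add]
  simp only [mFourier_torusProj, planeWave_add]

theorem planeWave_single (m : Fin n → ℤ) (i : Fin n) (t : ℝ) :
    planeWave m (t • EuclideanSpace.single i 1) =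
      Complex.exp (2 * Real.pi * Complex.I * m i * t) := by
  simp only [planeWave]
  congr 1
  rw [Finset.sum_eq_single i]
  · simp
    ring
  · intro j _ hj
    simp [hj]
  · simp

/-- Fourier coefficients of a partial derivative. Instead of integrating by parts, one
differentiates the identity `∫ F(y + t eᵢ) e₋ₘ(y) dy = eₘ(t eᵢ) ∫ F e₋ₘ` at `t = 0`. -/
theorem mFourierCoeff_partialDeriv {f : E n → ℂ} (hf : Differentiable ℝ f) (i : Fin n)
    {g h : C(UnitAddTorus (Fin n), ℂ)} (hg : ∀ x, g (torusProj x) = f x)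
    (hh : ∀ x, h (torusProj x) = fderiv ℝ f x (EuclideanSpace.single i 1)) (m : Fin n → ℤ) :
    mFourierCoeff h m = 2 * Real.pi * Complex.I * m i * mFourierCoeff g m := by
  let a : ℝ → UnitAddTorus (Fin n) := fun t => torusProj (t • EuclideanSpace.single i 1)
  let k : ℝ → ℂ := fun t => ∫ y, mFourier (-m) y • g (y + a t)
  have ha0 : a 0 = 0 := by
    funext j
    simp [a, torusProj]
  have hint : ∀ f : C(UnitAddTorus (Fin n), ℂ), Integrable f := fun f =>
    f.continuous.integrable_of_hasCompactSupport (HasCompactSupport.of_compactSpace _)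
  have hcont : ∀ (f : C(UnitAddTorus (Fin n), ℂ)) t,
      Continuous fun y => mFourier (-m) y • f (y + a t) := fun f t => by fun_prop
  have hk : HasDerivAt k (∫ y, mFourier (-m) y • h (y + a 0)) 0 := by
    refine (hasDerivAt_integral_of_dominated_loc_of_deriv_le
      (F' := fun t y => mFourier (-m) y • h (y + a t)) (bound := fun _ => ‖h‖)
      Filter.univ_mem ?_ ?_ ?_ ?_ (integrable_const _) ?_).2
    · exact Filter.Eventually.of_forall fun t => (hcont g t).aestronglyMeasurable
    · exact hint ⟨_, hcont g 0⟩
    · exact (hcont h 0).aestronglyMeasurable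
    · refine Filter.Eventually.of_forall fun y t _ => ?_
      have h1 := (mFourier (-m)).norm_coe_le_norm y
      rw [mFourier_norm] at h1
      rw [norm_smul]
      calc _ ≤ 1 * ‖h‖ := mul_le_mul h1 (h.norm_coe_le_norm _) (norm_nonneg _) zero_le_one
        _ = ‖h‖ := one_mul _
    · refine Filter.Eventually.of_forall fun y t _ => ?_
      obtain ⟨x, rfl⟩ := isOpenQuotientMap_torusProj.surjective y
      refine HasDerivAt.const_smul (mFourier (-m) (torusProj x)) ?_
      simp only [a, ← torusProj_add, hg, hh]
      have h2 : HasDerivAt (fun t : ℝ => x + t • (EuclideanSpace.single i 1 : E n))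
          (EuclideanSpace.single i 1) t := by
        simpa using ((hasDerivAt_id t).smul_const (EuclideanSpace.single i 1 : E n)).const_add x
      exact (hf _).hasFDerivAt.comp_hasDerivAt t h2
  -- The translation invariance of the Haar measure.
  have hconst : ∀ t : ℝ, Complex.exp (2 * Real.pi * Complex.I * (-m) i * t) * k t =
      mFourierCoeff g m := fun t => by
    rw [← planeWave_single, ← mFourier_torusProj, ← integral_const_mul, mFourierCoeff,
      ← integral_add_right_eq_self (fun y => mFourier (-m) y • g y) (a t)]
    refine integral_congr_ae (Filter.Eventually.of_forall fun y => ?_)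
    simp only [mFourier_apply_add, smul_eq_mul, a]
    ring
  have hexp : HasDerivAt (fun t : ℝ => Complex.exp (2 * Real.pi * Complex.I * (-m) i * t))
      (2 * Real.pi * Complex.I * (-m) i) 0 := by
    have h3 : HasDerivAt (fun t : ℝ => 2 * Real.pi * Complex.I * ((-m) i : ℤ) * (t : ℂ))
        (2 * Real.pi * Complex.I * ((-m) i : ℤ)) 0 := by
      simpa using (Complex.ofRealCLM.hasDerivAt (x := (0 : ℝ))).const_mul
        (2 * Real.pi * Complex.I * ((-m) i : ℤ))
    simpa using h3.cexp
  have h4 := (hexp.mul hk).unique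
    ((hasDerivAt_const (0 : ℝ) (mFourierCoeff g m)).congr_of_eventuallyEq
      (Filter.Eventually.of_forall hconst))
  have h5 : k 0 = mFourierCoeff g m := by simpa using hconst 0
  have h6 : ∫ y, mFourier (-m) y • h (y + a 0) = mFourierCoeff h m := by
    simp [ha0, mFourierCoeff]
  rw [h5, h6] at h4
  simp at h4
  linear_combination h4

theorem isPeriodic_fderiv {f : E n → F} (hp : IsPeriodic f) (v : E n) :
    IsPeriodic fun x => fderiv ℝ f x v := fun m x => by
  have h : (fun y => f (y + intVec m)) = f := funext (hp m)
  change fderiv ℝ f (x + intVec m) v = _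
  rw [← fderiv_comp_add_right, h]

/-- The lattice vectors `m` with `4π²|m|² = μ`, the frequencies of the eigenfunctions of the
Laplacian on `ℝⁿ/ℤⁿ` with eigenvalue `μ`. -/
def frequencies (n : ℕ) (μ : ℝ) : Set (Fin n → ℤ) :=
  {m | 4 * Real.pi ^ 2 * ∑ i, (m i : ℝ) ^ 2 = μ}

theorem finite_frequencies (n : ℕ) (μ : ℝ) : (frequencies n μ).Finite := by
  refine (Set.finite_Icc (fun _ : Fin n => -⌈μ⌉) (fun _ => ⌈μ⌉)).subset fun m hm => ?_
  have h1 : ∀ i, |m i| ≤ ⌈μ⌉ := fun i => by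
    have h2 : (m i : ℝ) ^ 2 ≤ ∑ j, (m j : ℝ) ^ 2 :=
      Finset.single_le_sum (f := fun j => (m j : ℝ) ^ 2) (fun j _ => sq_nonneg _)
        (Finset.mem_univ i)
    have h3 : ((|m i| : ℤ) : ℝ) ≤ (m i : ℝ) ^ 2 := by
      have : |m i| ≤ (m i) ^ 2 := by
        rw [← sq_abs]
        exact Int.le_self_sq _
      exact_mod_cast this
    have h4 : (1 : ℝ) ≤ 4 * Real.pi ^ 2 := by nlinarith [Real.pi_gt_three]
    have h5 : (0 : ℝ) ≤ ∑ j, (m j : ℝ) ^ 2 := Finset.sum_nonneg fun j _ => sq_nonneg _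
    have h6 : 4 * Real.pi ^ 2 * ∑ i, (m i : ℝ) ^ 2 = μ := hm
    have h7 : ((|m i| : ℤ) : ℝ) ≤ (⌈μ⌉ : ℤ) := by
      have := Int.le_ceil μ
      nlinarith
    exact_mod_cast h7
  exact ⟨fun i => (abs_le.1 (h1 i)).1, fun i => (abs_le.1 (h1 i)).2⟩

instance (n : ℕ) (μ : ℝ) : Fintype (frequencies n μ) := (finite_frequencies n μ).fintype

/-- The equation `Δf = μf` reads `4π²|m|² f̂(m) = μ f̂(m)` on Fourier coefficients, so that only
finitely many of them are nonzero and the Fourier series is a finite sum. -/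
theorem exists_planeWave_expansion_scalar {f : E n → ℂ} (hf : ContDiff ℝ ∞ f) (hp : IsPeriodic f)
    {μ : ℝ} (hμ : flatLaplacian f = (μ : ℂ) • f) :
    ∃ c : frequencies n μ → ℂ, ∀ x, f x = ∑ m, planeWave m.1 x * c m := by
  have hd : Differentiable ℝ f := hf.differentiable (by simp)
  have hf1 : ContDiff ℝ ∞ (fderiv ℝ f) := hf.fderiv_right (by simp)
  have hfi : ∀ i : Fin n, ContDiff ℝ ∞ fun x => fderiv ℝ f x (EuclideanSpace.single i 1) :=
    fun i => hf1.clm_apply contDiff_const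
  have hfii : ∀ i : Fin n, ContDiff ℝ ∞ fun x =>
      fderiv ℝ (fun x => fderiv ℝ f x (EuclideanSpace.single i 1)) x (EuclideanSpace.single i 1) :=
    fun i => ((hfi i).fderiv_right (m := ∞) (by simp)).clm_apply contDiff_const
  obtain ⟨g, hg⟩ := exists_torus_lift hf.continuous hp
  choose g1 hg1 using fun i => exists_torus_lift (hfi i).continuous (isPeriodic_fderiv hp _)
  choose g2 hg2 using fun i => exists_torus_lift (hfii i).continuous
    (isPeriodic_fderiv (isPeriodic_fderiv hp _) _)
  have hg0 : -∑ i, g2 i = (μ : ℂ) • g := by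
    ext y
    obtain ⟨x, rfl⟩ := isOpenQuotientMap_torusProj.surjective y
    have := congrFun hμ x
    simp only [flatLaplacian, Pi.smul_apply] at this
    simp only [ContinuousMap.neg_apply, ContinuousMap.sum_apply, ContinuousMap.smul_apply, hg2, hg,
      ← this]
    congr 1
    refine Finset.sum_congr rfl fun i _ => ?_
    rw [fderiv_clm_apply (hf1.differentiable (by simp) x) (differentiableAt_const _)]
    simp
  have hint : ∀ f : C(UnitAddTorus (Fin n), ℂ), Integrable f := fun f =>
    f.continuous.integrable_of_hasCompactSupport (HasCompactSupport.of_compactSpace _)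
  have hco : ∀ m, (4 * Real.pi ^ 2 * ∑ i, (m i : ℂ) ^ 2) * mFourierCoeff g m =
      μ * mFourierCoeff g m := fun m => by
    have h1 : mFourierCoeff (-∑ i, g2 i : C(UnitAddTorus (Fin n), ℂ)) m =
        -∑ i, mFourierCoeff (g2 i) m := by
      simp only [mFourierCoeff]
      have h3 := integral_finsetSum (μ := volume) Finset.univ
        fun i _ => hint (mFourier (-m) * g2 i)
      simp only [ContinuousMap.mul_apply] at h3
      simp only [smul_eq_mul]
      rw [← h3, ← integral_neg]
      congr 1
      funext t
      simp [Finset.mul_sum]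
    have h2 : mFourierCoeff ((μ : ℂ) • g : C(UnitAddTorus (Fin n), ℂ)) m =
        μ * mFourierCoeff g m := by
      simp only [mFourierCoeff]
      rw [← integral_const_mul]
      congr 1
      funext t
      simp
      ring
    rw [← h2, ← hg0, h1, Finset.mul_sum, Finset.sum_mul, ← Finset.sum_neg_distrib]
    refine Finset.sum_congr rfl fun i _ => ?_
    rw [mFourierCoeff_partialDeriv ((hfi i).differentiable (by simp)) i (hg1 i) (hg2 i),
      mFourierCoeff_partialDeriv hd i hg (hg1 i)]
    linear_combination (4 * Real.pi ^ 2 * (m i) ^ 2 * mFourierCoeff g m) * Complex.I_sq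
  have hz : ∀ m ∉ frequencies n μ, mFourierCoeff g m = 0 := fun m hm => by
    by_contra h
    have h1 := mul_right_cancel₀ h (hco m)
    have h2 : 4 * Real.pi ^ 2 * ∑ i, (m i : ℝ) ^ 2 = μ := by exact_mod_cast h1
    exact hm h2
  have hs : Summable (mFourierCoeff g) :=
    summable_of_hasFiniteSupport ((finite_frequencies n μ).subset fun m hm => by
      by_contra h
      exact hm (hz m h))
  refine ⟨fun m => mFourierCoeff g m.1, fun x => ?_⟩
  have h1 := hasSum_mFourier_series_apply_of_summable hs (torusProj x)
  have h2 : HasSum (fun i => mFourierCoeff g i • mFourier i (torusProj x))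
      (∑ i ∈ (finite_frequencies n μ).toFinset, mFourierCoeff g i • mFourier i (torusProj x)) :=
    hasSum_sum_of_ne_finset_zero fun m hm => by
      rw [hz m (by simpa using hm), zero_smul]
  rw [← hg, h1.unique h2]
  simp only [mFourier_torusProj]
  rw [Finset.sum_subtype (p := fun m => m ∈ frequencies n μ) _ (by simp)]
  exact Finset.sum_congr rfl fun m _ => mul_comm _ _

theorem linearIndependent_planeWave : LinearIndependent ℂ (planeWave (n := n)) := by
  have h1 : LinearIndependent ℂ (mFourier (d := Fin n)) :=
    LinearIndependent.of_comp (ContinuousMap.toLp 2 volume ℂ).toLinearMap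
      (orthonormal_mFourier (d := Fin n)).linearIndependent
  let A : C(UnitAddTorus (Fin n), ℂ) →ₗ[ℂ] (E n → ℂ) :=
    { toFun := fun g x => g (torusProj x)
      map_add' := fun _ _ => rfl
      map_smul' := fun _ _ => rfl }
  have h2 : planeWave (n := n) = A ∘ mFourier := by
    funext m x
    exact (mFourier_torusProj m x).symm
  rw [h2]
  refine h1.map' A (LinearMap.ker_eq_bot.2 fun g g' h => ?_)
  ext y
  obtain ⟨x, rfl⟩ := isOpenQuotientMap_torusProj.surjective y
  exact congrFun h x

end Fourier

section Synthesis

variable {n : ℕ} {F : Type} [NormedAddCommGroup F] [NormedSpace ℂ F]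

/-- The trigonometric polynomial `∑ₘ exp (2πi ⟨m, x⟩) cₘ` over the frequencies of the eigenvalue
`μ`. -/
def synthesis (n : ℕ) (F : Type) [NormedAddCommGroup F] [NormedSpace ℂ F] (μ : ℝ) :
    (frequencies n μ → F) →ₗ[ℂ] (E n → F) where
  toFun c x := ∑ m, planeWave m.1 x • c m
  map_add' c d := by
    funext x
    simp [Finset.sum_add_distrib]
  map_smul' a c := by
    funext x
    simp only [Pi.smul_apply, Finset.smul_sum, RingHom.id_apply]
    exact Finset.sum_congr rfl fun m _ => smul_comm _ _ _

theorem synthesis_apply {μ : ℝ} (c : frequencies n μ → F) (x : E n) :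
    synthesis n F μ c x = ∑ m, planeWave m.1 x • c m := rfl

theorem synthesis_injective [FiniteDimensional ℂ F] (μ : ℝ) :
    Function.Injective (synthesis n F μ) := by
  rw [injective_iff_map_eq_zero]
  intro c hc
  let b := Module.finBasis ℂ F
  have hl : LinearIndependent ℂ fun m : frequencies n μ => planeWave m.1 :=
    linearIndependent_planeWave.comp _ Subtype.val_injective
  funext m
  refine b.ext_elem fun j => ?_
  have h1 := Fintype.linearIndependent_iff.1 hl (fun m => b.repr (c m) j) (by
    funext x
    have h2 := congrArg (fun v => b.repr v j) (congrFun hc x)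
    simp only [synthesis_apply, map_sum, map_smul, Finsupp.coe_finsetSum, Finset.sum_apply,
      Finsupp.smul_apply, smul_eq_mul, Pi.zero_apply, map_zero, Finsupp.coe_zero] at h2
    simp only [Finset.sum_apply, Pi.smul_apply, smul_eq_mul, Pi.zero_apply]
    rw [← h2]
    exact Finset.sum_congr rfl fun m _ => mul_comm _ _) m
  simpa using h1

end Synthesis

section VectorValued

variable {n : ℕ} {F : Type} [NormedAddCommGroup F] [NormedSpace ℝ F] [NormedSpace ℂ F]
  [IsScalarTower ℝ ℂ F]

theorem contDiff_planeWave (m : Fin n → ℤ) : ContDiff ℝ ∞ (planeWave m) := by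
  unfold planeWave
  refine ContDiff.cexp (contDiff_const.mul (ContDiff.sum fun i _ => contDiff_const.mul ?_))
  exact Complex.ofRealCLM.contDiff.comp (contDiff_piLp_apply (p := 2) (i := i))

theorem fderiv_planeWave_smul (m : Fin n → ℤ) (c : F) (x v : E n) :
    fderiv ℝ (fun y => planeWave m y • c) x v =
      planeWave m x • (2 * Real.pi * Complex.I * ∑ i, (m i : ℂ) * (v i : ℂ)) • c := by
  have h1 : DifferentiableAt ℝ (fun y => planeWave m y • c) x :=
    ((contDiff_planeWave m).smul contDiff_const).differentiable (by simp) x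
  rw [← h1.lineDeriv_eq_fderiv]
  have h2 : ∀ t : ℝ, planeWave m (x + t • v) • c =
      Complex.exp ((2 * Real.pi * Complex.I * ∑ i, (m i : ℂ) * (v i : ℂ)) * t) •
        planeWave m x • c := fun t => by
    rw [planeWave_add, mul_comm, mul_smul]
    congr 1
    simp only [planeWave]
    congr 1
    rw [mul_assoc _ _ (t : ℂ), Finset.sum_mul]
    congr 1
    refine Finset.sum_congr rfl fun i _ => ?_
    simp
    ring
  have h3 : HasDerivAt (fun t : ℝ => (2 * Real.pi * Complex.I * ∑ i, (m i : ℂ) * (v i : ℂ)) * t)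
      (2 * Real.pi * Complex.I * ∑ i, (m i : ℂ) * (v i : ℂ)) 0 := by
    simpa using (Complex.ofRealCLM.hasDerivAt (x := (0 : ℝ))).const_mul
      (2 * Real.pi * Complex.I * ∑ i, (m i : ℂ) * (v i : ℂ))
  have h4 := (h3.cexp.smul_const (planeWave m x • c)).deriv
  simp only [lineDeriv, h2]
  rw [h4, smul_comm]
  simp

theorem flatLaplacian_planeWave_smul (m : Fin n → ℤ) (c : F) :
    flatLaplacian (fun y => planeWave m y • c) =
      fun y => (4 * Real.pi ^ 2 * ∑ i, (m i : ℂ) ^ 2) • planeWave m y • c := by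
  funext x
  have h1 : ContDiff ℝ ∞ (fun y => planeWave m y • c) :=
    (contDiff_planeWave m).smul contDiff_const
  have h2 : DifferentiableAt ℝ (fderiv ℝ (fun y => planeWave m y • c)) x :=
    (h1.fderiv_right (m := ∞) (by simp)).differentiable (by simp) x
  have h3 : ∀ v : E n, fderiv ℝ (fderiv ℝ (fun y => planeWave m y • c)) x v v =
      planeWave m x • (2 * Real.pi * Complex.I * ∑ i, (m i : ℂ) * (v i : ℂ)) •
        (2 * Real.pi * Complex.I * ∑ i, (m i : ℂ) * (v i : ℂ)) • c := fun v => by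
    have h4 : fderiv ℝ (fun y => fderiv ℝ (fun y => planeWave m y • c) y v) x v =
        fderiv ℝ (fderiv ℝ (fun y => planeWave m y • c)) x v v := by
      rw [fderiv_clm_apply h2 (differentiableAt_const _)]
      simp
    rw [← h4]
    simp only [fderiv_planeWave_smul]
  have h5 : ∀ i : Fin n, ∑ j, (m j : ℂ) * ((EuclideanSpace.single i (1 : ℝ) : E n) j : ℂ) = m i :=
    fun i => by
      rw [Finset.sum_eq_single i]
      · simp
      · intro j _ hj
        simp [hj]
      · simp
  simp only [flatLaplacian, h3, h5, smul_smul, ← Finset.sum_smul, ← neg_smul]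
  congr 1
  rw [← Finset.sum_neg_distrib, Finset.mul_sum, Finset.sum_mul]
  refine Finset.sum_congr rfl fun i _ => ?_
  linear_combination (-4 * Real.pi ^ 2 * (m i : ℂ) ^ 2 * planeWave m x) * Complex.I_sq

theorem contDiff_synthesis {μ : ℝ} (c : frequencies n μ → F) :
    ContDiff ℝ ∞ (synthesis n F μ c) :=
  ContDiff.sum fun m _ => (contDiff_planeWave m.1).smul contDiff_const

theorem flatLaplacian_synthesis {μ : ℝ} (c : frequencies n μ → F) :
    flatLaplacian (synthesis n F μ c) = (μ : ℂ) • synthesis n F μ c := by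
  have h : ∀ s : Finset (frequencies n μ),
      flatLaplacian (∑ m ∈ s, fun x => planeWave m.1 x • c m) =
        (μ : ℂ) • ∑ m ∈ s, fun x => planeWave m.1 x • c m := fun s => by
    classical
    induction s using Finset.induction_on with
    | empty => simp [flatLaplacian_zero]
    | insert m s hm ih =>
      have h1 : ContDiff ℝ ∞ (∑ m ∈ s, fun x => planeWave m.1 x • c m) := by
        rw [show (∑ m ∈ s, fun x => planeWave m.1 x • c m) =
          fun x => ∑ m ∈ s, planeWave m.1 x • c m by funext x; simp]
        exact ContDiff.sum fun m _ => (contDiff_planeWave m.1).smul contDiff_const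
      have h1' : ContDiff ℝ ∞ fun x => planeWave m.1 x • c m :=
        (contDiff_planeWave m.1).smul contDiff_const
      rw [Finset.sum_insert hm, flatLaplacian_add h1' h1,
        ih, flatLaplacian_planeWave_smul, smul_add]
      congr 1
      funext x
      have h2 : 4 * Real.pi ^ 2 * ∑ i, (m.1 i : ℝ) ^ 2 = μ := m.2
      have h3 : (4 * Real.pi ^ 2 * ∑ i, (m.1 i : ℂ) ^ 2) = (μ : ℂ) := by exact_mod_cast h2
      rw [h3]
      rfl
  have h0 : synthesis n F μ c = ∑ m, fun x => planeWave m.1 x • c m := by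
    funext x
    simp [synthesis_apply]
  rw [h0]
  exact h _

variable [FiniteDimensional ℂ F]

/-- A smooth periodic eigenfunction of the Laplacian is a trigonometric polynomial: by
`mFourierCoeff_partialDeriv` its Fourier coefficients vanish at all other frequencies. -/
theorem exists_synthesis_eq {f : E n → F} (hf : ContDiff ℝ ∞ f) (hp : IsPeriodic f) {μ : ℝ}
    (hμ : flatLaplacian f = (μ : ℂ) • f) : ∃ c, synthesis n F μ c = f := by
  -- The scalar expansion is applied to the coordinates with respect to a basis of `F`.
  let b := Module.finBasis ℂ F
  let l : Fin (Module.finrank ℂ F) → F →L[ℝ] ℂ := fun j =>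
    (LinearMap.toContinuousLinearMap (b.coord j)).restrictScalars ℝ
  have hl : ∀ j (a : ℂ) v, l j (a • v) = a * l j v := fun j a v =>
    (b.coord j).map_smul a v
  have hL : ∀ j, flatLaplacian (fun x => l j (f x)) = (μ : ℂ) • fun x => l j (f x) := fun j => by
    have h1 : fderiv ℝ (fun x => l j (f x)) = fun x => (l j).comp (fderiv ℝ f x) :=
      funext fun x => ((l j).hasFDerivAt.comp x
        (hf.differentiable (by simp) x).hasFDerivAt).fderiv
    have h2 : ∀ x, fderiv ℝ (fun x => (l j).comp (fderiv ℝ f x)) x =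
        (ContinuousLinearMap.compL ℝ (E n) F ℂ (l j)).comp (fderiv ℝ (fderiv ℝ f) x) := fun x =>
      ((ContinuousLinearMap.compL ℝ (E n) F ℂ (l j)).hasFDerivAt.comp x
        ((hf.fderiv_right (m := ∞) (by simp)).differentiable (by simp) x).hasFDerivAt).fderiv
    funext x
    have h3 := congrArg (l j) (congrFun hμ x)
    simp only [flatLaplacian, Pi.smul_apply, hl, map_neg, map_sum] at h3
    simp only [flatLaplacian, h1, h2, Pi.smul_apply, smul_eq_mul, ← h3]
    rfl
  choose c hc using fun j => exists_planeWave_expansion_scalar ((l j).contDiff.comp hf)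
    (fun m x => congrArg (l j) (hp m x)) (hL j)
  refine ⟨fun m => ∑ j, c j m • b j, ?_⟩
  funext x
  rw [← b.sum_repr (f x), synthesis_apply]
  simp only [Finset.smul_sum, smul_smul]
  rw [Finset.sum_comm]
  refine Finset.sum_congr rfl fun j _ => ?_
  rw [← Finset.sum_smul, ← hc j x]
  rfl

end VectorValued

/-! ### Isometries modulo the lattice -/

/-- A class modulo `ℤⁿ` of isometries `x ↦ B (x + b)` with `B` integral orthogonal and `4b`
integral: the matrix `B`, and `4b` modulo `4`. -/
@[ext]
structure QuarterIso (n : ℕ) where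
  /-- the linear part `B` -/
  lin : Matrix (Fin n) (Fin n) ℤ
  orth : lin * linᵀ = 1
  /-- the vector `4b` modulo `4` -/
  shift : Fin n → ZMod 4

namespace QuarterIso

variable {n : ℕ}

theorem orth' (q : QuarterIso n) : q.linᵀ * q.lin = 1 := mul_eq_one_comm.1 q.orth

instance : Mul (QuarterIso n) :=
  ⟨fun q r => ⟨q.lin * r.lin, by
    rw [Matrix.transpose_mul, Matrix.mul_assoc, ← Matrix.mul_assoc r.lin, r.orth, Matrix.one_mul,
      q.orth], r.shift + (r.linᵀ.map (Int.cast : ℤ → ZMod 4)) *ᵥ q.shift⟩⟩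

instance : One (QuarterIso n) := ⟨⟨1, by simp, 0⟩⟩

instance : Inv (QuarterIso n) :=
  ⟨fun q => ⟨q.linᵀ, by rw [Matrix.transpose_transpose, q.orth'],
    -((q.lin.map (Int.cast : ℤ → ZMod 4)) *ᵥ q.shift)⟩⟩

@[simp] theorem mul_lin (q r : QuarterIso n) : (q * r).lin = q.lin * r.lin := rfl

@[simp] theorem mul_shift (q r : QuarterIso n) :
    (q * r).shift = r.shift + (r.linᵀ.map (Int.cast : ℤ → ZMod 4)) *ᵥ q.shift := rfl

@[simp] theorem one_lin : (1 : QuarterIso n).lin = 1 := rfl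

@[simp] theorem one_shift : (1 : QuarterIso n).shift = 0 := rfl

@[simp] theorem inv_lin (q : QuarterIso n) : q⁻¹.lin = q.linᵀ := rfl

@[simp] theorem inv_shift (q : QuarterIso n) :
    q⁻¹.shift = -((q.lin.map (Int.cast : ℤ → ZMod 4)) *ᵥ q.shift) := rfl

instance : Group (QuarterIso n) :=
  Group.ofLeftAxioms
    (fun q r s => by
      ext1
      · simp [Matrix.mul_assoc]
      · simp [Matrix.map_mul_intCast, Matrix.mulVec_add, Matrix.mulVec_mulVec, add_assoc])
    (fun q => by
      ext1 <;> simp)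
    (fun q => by
      ext1
      · simp [q.orth']
      · have h : q.linᵀ.map (Int.cast : ℤ → ZMod 4) * q.lin.map (Int.cast : ℤ → ZMod 4) = 1 := by
          rw [← Matrix.map_mul_intCast, q.orth']
          simp
        simp [Matrix.mulVec_neg, Matrix.mulVec_mulVec, h])

/-- The projection to the linear part. -/
def linHom (n : ℕ) : QuarterIso n →* Matrix (Fin n) (Fin n) ℤ where
  toFun := lin
  map_one' := rfl
  map_mul' _ _ := rfl

@[simp] theorem pow_lin (q : QuarterIso n) (k : ℕ) : (q ^ k).lin = q.lin ^ k :=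
  map_pow (linHom n) q k

end QuarterIso

theorem rotTrans_apply {n : ℕ} (B : Matrix (Fin n) (Fin n) ℤ) (hB : B * Bᵀ = 1) (b x : E n) :
    rotTrans B hB b x = WithLp.toLp 2 (B.map (Int.cast : ℤ → ℝ) *ᵥ (b.ofLp + x.ofLp)) := rfl

theorem transl_apply {n : ℕ} (b x : E n) : transl b x = b + x := rfl

theorem linearPart_rotTrans {n : ℕ} (B : Matrix (Fin n) (Fin n) ℤ) (hB : B * Bᵀ = 1) (b : E n) :
    linearPart n (rotTrans B hB b) = matrixIso B hB := by
  ext v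
  rfl

theorem rotTrans_mul_rotTrans {n : ℕ} {B C D : Matrix (Fin n) (Fin n) ℤ} (hB : B * Bᵀ = 1)
    (hC : C * Cᵀ = 1) (hD : D * Dᵀ = 1) (h : D = B * C) (b c : E n) :
    rotTrans B hB b * rotTrans C hC c =
      rotTrans D hD (c + WithLp.toLp 2 (Cᵀ.map (Int.cast : ℤ → ℝ) *ᵥ b.ofLp)) := by
  subst h
  have h : C.map (Int.cast : ℤ → ℝ) * Cᵀ.map (Int.cast : ℤ → ℝ) = 1 := by
    rw [← Matrix.map_mul_intCast, hC]
    simp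
  ext1 x
  rw [AffineIsometryEquiv.coe_mul, Function.comp_apply, rotTrans_apply, rotTrans_apply,
    rotTrans_apply, Matrix.map_mul_intCast, ← Matrix.mulVec_mulVec]
  congr 2
  simp [Matrix.mulVec_add, Matrix.mulVec_mulVec, h]
  abel

theorem rotTrans_one {n : ℕ} (h : (1 : Matrix (Fin n) (Fin n) ℤ) * 1ᵀ = 1) (b : E n) :
    rotTrans 1 h b = transl b := by
  ext1 x
  rw [rotTrans_apply, transl_apply]
  simp

theorem rotTrans_inv {n : ℕ} (B : Matrix (Fin n) (Fin n) ℤ) (hB : B * Bᵀ = 1)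
    (hB' : Bᵀ * Bᵀᵀ = 1) (b : E n) :
    (rotTrans B hB b)⁻¹ =
      rotTrans Bᵀ hB' (-WithLp.toLp 2 (B.map (Int.cast : ℤ → ℝ) *ᵥ b.ofLp)) := by
  rw [inv_eq_iff_mul_eq_one, rotTrans_mul_rotTrans hB hB' (by simp) hB.symm, rotTrans_one]
  ext1 x
  rw [transl_apply]
  simp

/-- The isometry `g` belongs to the class `q`. -/
def IsLift {n : ℕ} (q : QuarterIso n) (g : Iso n) : Prop :=
  ∃ b : Fin n → ℤ, (∀ i, (b i : ZMod 4) = q.shift i) ∧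
    g = rotTrans q.lin q.orth ((1 / 4 : ℝ) • intVec b)

section IsLift

variable {n : ℕ} {q r : QuarterIso n} {g h : Iso n}

theorem intVec_mulVec (B : Matrix (Fin n) (Fin n) ℤ) (b : Fin n → ℤ) :
    intVec (B *ᵥ b) = WithLp.toLp 2 (B.map (Int.cast : ℤ → ℝ) *ᵥ (intVec b).ofLp) := by
  ext i
  simp [intVec, Matrix.mulVec, dotProduct]

theorem intVec_add (b c : Fin n → ℤ) : intVec (b + c) = intVec b + intVec c := by
  ext i
  simp [intVec]

theorem intVec_neg (b : Fin n → ℤ) : intVec (-b) = -intVec b := by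
  ext i
  simp [intVec]

theorem cast_mulVec (B : Matrix (Fin n) (Fin n) ℤ) (b : Fin n → ℤ) {s : Fin n → ZMod 4}
    (hb : ∀ i, (b i : ZMod 4) = s i) (i : Fin n) :
    (((B *ᵥ b) i : ℤ) : ZMod 4) = (B.map (Int.cast : ℤ → ZMod 4) *ᵥ s) i := by
  simp [Matrix.mulVec, dotProduct, hb]

theorem IsLift.mul (hg : IsLift q g) (hh : IsLift r h) : IsLift (q * r) (g * h) := by
  obtain ⟨b, hb, rfl⟩ := hg
  obtain ⟨c, hc, rfl⟩ := hh
  refine ⟨c + r.linᵀ *ᵥ b, fun i => ?_, ?_⟩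
  · simp [hc, cast_mulVec _ _ hb]
  · rw [rotTrans_mul_rotTrans q.orth r.orth (q * r).orth rfl, intVec_add, smul_add, intVec_mulVec]
    simp [Matrix.mulVec_smul]

theorem IsLift.inv (hg : IsLift q g) : IsLift q⁻¹ g⁻¹ := by
  obtain ⟨b, hb, rfl⟩ := hg
  refine ⟨-(q.lin *ᵥ b), fun i => ?_, ?_⟩
  · simp [cast_mulVec _ _ hb]
  · rw [rotTrans_inv q.lin q.orth q⁻¹.orth, intVec_neg, intVec_mulVec]
    simp [Matrix.mulVec_smul]

theorem isLift_one_iff : IsLift 1 g ↔ ∃ m, g = transl (intVec m) := by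
  constructor
  · rintro ⟨b, hb, rfl⟩
    have h1 : ∀ i, ∃ k, b i = 4 * k := fun i =>
      (ZMod.intCast_zmod_eq_zero_iff_dvd (b i) 4).1 (by simpa using hb i)
    choose k hk using h1
    refine ⟨k, ?_⟩
    have h2 : (1 / 4 : ℝ) • intVec b = intVec k := by
      ext i
      simp [intVec, hk]
    rw [h2]
    exact rotTrans_one _ _
  · rintro ⟨m, rfl⟩
    refine ⟨fun i => 4 * m i, fun i => ?_, ?_⟩
    · have : (4 : ZMod 4) = 0 := by decide
      simp [this]
    · have h2 : (1 / 4 : ℝ) • intVec (fun i => 4 * m i) = intVec m := by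
        ext i
        simp [intVec]
      rw [h2]
      exact (rotTrans_one _ _).symm

theorem exists_isLift (q : QuarterIso n) : ∃ g, IsLift q g :=
  ⟨_, fun i => ((q.shift i).val : ℤ), fun i => by simp, rfl⟩

theorem isLift_linearPart (hg : IsLift q g) : linearPart n g = matrixIso q.lin q.orth := by
  obtain ⟨b, -, rfl⟩ := hg
  exact linearPart_rotTrans _ _ _

end IsLift

/-- The preimage in `I(ℝⁿ)` of a finite group of classes of isometries modulo `ℤⁿ`. -/
def crystalGroup {n : ℕ} {G : Type} [Group G] (φ : G →* QuarterIso n) : Subgroup (Iso n) where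
  carrier := {g | ∃ x, IsLift (φ x) g}
  mul_mem' := by
    rintro g h ⟨x, hx⟩ ⟨y, hy⟩
    exact ⟨x * y, by rw [map_mul]; exact hx.mul hy⟩
  one_mem' := ⟨1, by rw [map_one, isLift_one_iff]; exact ⟨0, by ext1 x; simp [transl, intVec]; rfl⟩⟩
  inv_mem' := by
    rintro g ⟨x, hx⟩
    exact ⟨x⁻¹, by rw [map_inv]; exact hx.inv⟩

theorem transl_intVec_mem {n : ℕ} {G : Type} [Group G] (φ : G →* QuarterIso n) (m : Fin n → ℤ) :
    transl (intVec m) ∈ crystalGroup φ :=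
  ⟨1, by rw [map_one]; exact isLift_one_iff.2 ⟨m, rfl⟩⟩

/-! ### Traces on exterior powers -/

section ExteriorTrace

/-- The fibre `Λᵖ(ℝⁿ)* ⊗ ℂ` of the bundle of complex-valued `p`-forms. -/
abbrev Cov (n p : ℕ) : Type := E n [⋀^Fin p]→L[ℝ] ℂ

variable {n p : ℕ}

/-- The continuous linear map given by an integral matrix. -/
def matrixCLM (B : Matrix (Fin n) (Fin n) ℤ) : E n →L[ℝ] E n :=
  LinearMap.toContinuousLinearMap (Matrix.toEuclideanLin (B.map (Int.cast : ℤ → ℝ)))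

theorem matrixCLM_apply (B : Matrix (Fin n) (Fin n) ℤ) (x : E n) :
    matrixCLM B x = WithLp.toLp 2 (B.map (Int.cast : ℤ → ℝ) *ᵥ x.ofLp) := rfl

/-- The action of an integral matrix on `Λᵖ(ℝⁿ)* ⊗ ℂ` by pull-back. -/
def covPull (p : ℕ) (B : Matrix (Fin n) (Fin n) ℤ) : Cov n p →ₗ[ℂ] Cov n p where
  toFun α := α.compContinuousLinearMap (matrixCLM B)
  map_add' _ _ := rfl
  map_smul' _ _ := rfl

theorem covPull_apply (B : Matrix (Fin n) (Fin n) ℤ) (α : Cov n p) (v : Fin p → E n) :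
    covPull p B α v = α fun i => matrixCLM B (v i) := rfl

theorem covPull_one : covPull p (1 : Matrix (Fin n) (Fin n) ℤ) = 1 := by
  ext α v
  simp [covPull_apply, matrixCLM_apply]

theorem covPull_mul (B C : Matrix (Fin n) (Fin n) ℤ) :
    covPull p (B * C) = covPull p C * covPull p B := by
  ext α v
  simp [covPull_apply, matrixCLM_apply, Matrix.map_mul_intCast]

theorem covPull_neg (B : Matrix (Fin n) (Fin n) ℤ) :
    covPull p (-B) = (-1 : ℂ) ^ p • covPull p B := by
  ext α v
  have h : ∀ x, matrixCLM (-B) x = (-1 : ℝ) • matrixCLM B x := fun x => by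
    ext i
    simp [matrixCLM_apply, Matrix.neg_mulVec, Matrix.map_neg]
  have h1 := α.map_smul_univ (fun _ : Fin p => (-1 : ℝ)) (fun i => matrixCLM B (v i))
  simp only [covPull_apply, h, LinearMap.smul_apply, ContinuousAlternatingMap.smul_apply]
  rw [h1]
  simp

/-- The trace of the pull-back by `B` on `Λᵖ(ℝⁿ)* ⊗ ℂ`. -/
def extTrace (p : ℕ) (B : Matrix (Fin n) (Fin n) ℤ) : ℂ :=
  LinearMap.trace ℂ (Cov n p) (covPull p B)

theorem extTrace_eq_of_conj {B C P : Matrix (Fin n) (Fin n) ℤ} (hP : P * Pᵀ = 1)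
    (h : P * B = C * P) : extTrace p C = extTrace p B := by
  have h1 : C = P * B * Pᵀ := by rw [h, Matrix.mul_assoc, hP, Matrix.mul_one]
  rw [h1, extTrace, covPull_mul, covPull_mul, ← mul_assoc, LinearMap.trace_mul_comm,
    ← mul_assoc, ← covPull_mul, mul_eq_one_comm.1 hP, covPull_one, one_mul, extTrace]

/-- If `B` is conjugate to `-B`, then its trace on the odd exterior powers vanishes. -/
theorem extTrace_eq_zero_of_odd (hp : Odd p) {B P : Matrix (Fin n) (Fin n) ℤ} (hP : P * Pᵀ = 1)
    (h : P * B = -(B * P)) : extTrace p B = 0 := by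
  have h2 : extTrace p (-B) = extTrace p B :=
    extTrace_eq_of_conj hP (by rw [h, Matrix.neg_mul])
  rw [extTrace, covPull_neg, hp.neg_one_pow, map_smul, neg_one_smul] at h2
  exact self_eq_neg.1 h2.symm

open Set Set.powersetCard in
/-- The elementary `p`-form `dx_{s₁} ∧ ⋯ ∧ dx_{s_p}`. -/
def elemForm (s : powersetCard (Fin n) p) : Cov n p :=
  let A : E n [⋀^Fin p]→ₗ[ℝ] ℂ := (Complex.ofRealCLM.toLinearMap ∘ₗ exteriorPower.ιMultiDual ℝ p
    (EuclideanSpace.basisFun (Fin n) ℝ).toBasis s).compAlternatingMap (exteriorPower.ιMulti ℝ p)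
  { toContinuousMultilinearMap :=
      { toMultilinearMap := A.toMultilinearMap
        cont := by
          change Continuous fun v => A v
          simp only [A, LinearMap.compAlternatingMap_apply, LinearMap.comp_apply,
            exteriorPower.ιMultiDual_apply_ιMulti]
          refine Complex.ofRealCLM.continuous.comp (Continuous.matrix_det ?_)
          refine continuous_matrix fun i j => ?_
          simp only [Matrix.of_apply, Module.Basis.coord_apply,
            OrthonormalBasis.coe_toBasis_repr_apply, EuclideanSpace.basisFun_repr]
          fun_prop }
    map_eq_zero_of_eq' := A.map_eq_zero_of_eq' }

open Set Set.powersetCard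

theorem elemForm_apply (s : powersetCard (Fin n) p) (v : Fin p → E n) :
    elemForm s v = ((exteriorPower.ιMultiDual ℝ p (EuclideanSpace.basisFun (Fin n) ℝ).toBasis s
      (exteriorPower.ιMulti ℝ p v) : ℝ) : ℂ) := rfl

/-- The coordinates of a `p`-covector: its values on the `p`-tuples of standard basis vectors with
increasing indices. -/
def covCoord (n p : ℕ) : Cov n p →ₗ[ℂ] (powersetCard (Fin n) p → ℂ) where
  toFun α s := α fun i => EuclideanSpace.basisFun (Fin n) ℝ (ofFinEmbEquiv.symm s i)
  map_add' _ _ := rfl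
  map_smul' _ _ := rfl

theorem covCoord_elemForm (s : powersetCard (Fin n) p) :
    covCoord n p (elemForm s) = Pi.single s 1 := by
  funext t
  change ((exteriorPower.ιMultiDual ℝ p (EuclideanSpace.basisFun (Fin n) ℝ).toBasis s
    (exteriorPower.ιMulti_family ℝ p (EuclideanSpace.basisFun (Fin n) ℝ).toBasis t) : ℝ) : ℂ) = _
  by_cases h : s = t
  · subst h
    rw [exteriorPower.ιMultiDual_apply_diag]
    simp
  · rw [exteriorPower.ιMultiDual_apply_nondiag _ _ _ _ _ h]
    simp [Ne.symm h]

theorem covCoord_bijective (n p : ℕ) : Function.Bijective (covCoord n p) := by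
  constructor
  · rw [injective_iff_map_eq_zero]
    intro α h
    have h1 : exteriorPower.alternatingMapLinearEquiv (α.toAlternatingMap) = 0 := by
      refine ((EuclideanSpace.basisFun (Fin n) ℝ).toBasis.exteriorPower p).ext fun s => ?_
      rw [exteriorPower.basis_apply, exteriorPower.ιMulti_family,
        exteriorPower.alternatingMapLinearEquiv_apply_ιMulti]
      exact congrFun h s
    have h2 := (LinearEquiv.map_eq_zero_iff _).1 h1
    ext v
    exact DFunLike.congr_fun h2 v
  · intro a
    refine ⟨∑ s, a s • elemForm s, ?_⟩
    simp only [map_sum, map_smul, covCoord_elemForm]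
    exact (pi_eq_sum_univ' a).symm

/-- The basis of elementary forms. -/
def covBasis (n p : ℕ) : Module.Basis (powersetCard (Fin n) p) ℂ (Cov n p) :=
  Module.Basis.ofEquivFun (LinearEquiv.ofBijective (covCoord n p) (covCoord_bijective n p))

theorem covBasis_apply (s : powersetCard (Fin n) p) : covBasis n p s = elemForm s := by
  apply (covCoord_bijective n p).1
  rw [covCoord_elemForm]
  simp [covBasis]

instance : FiniteDimensional ℂ (Cov n p) := (covBasis n p).finiteDimensional_of_finite

/-- The trace on `Λᵖ` is the sum of the principal minors of size `p`, that is, a coefficient of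
`det (1 + X B)`. -/
theorem extTrace_eq_coeff (B : Matrix (Fin n) (Fin n) ℤ) :
    extTrace p B =
      (((1 + (Polynomial.X : Polynomial ℤ) • B.map Polynomial.C).det.coeff p : ℤ) : ℂ) := by
  rw [Matrix.coeff_det_one_add_X_smul_eq_sum_minors, extTrace,
    LinearMap.trace_eq_matrix_trace ℂ (covBasis n p), Matrix.trace, Int.cast_sum,
    Finset.sum_subtype (p := fun s => s ∈ powersetCard (Fin n) p) _
      (fun s => by simp [Finset.mem_powersetCard, mem_iff])]
  refine Finset.sum_congr rfl fun s _ => ?_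
  have h1 : Matrix.diag (LinearMap.toMatrix (covBasis n p) (covBasis n p) (covPull p B)) s =
      covCoord n p (covPull p B (elemForm s)) s := by
    rw [Matrix.diag_apply, LinearMap.toMatrix_apply, covBasis_apply]
    rfl
  rw [h1]
  change elemForm s (fun i => matrixCLM B (EuclideanSpace.basisFun (Fin n) ℝ
    (ofFinEmbEquiv.symm s i))) = _
  rw [elemForm_apply, exteriorPower.ιMultiDual_apply_ιMulti]
  have h2 : (Matrix.of fun i j => (EuclideanSpace.basisFun (Fin n) ℝ).toBasis.coord
      (ofFinEmbEquiv.symm s j) (matrixCLM B (EuclideanSpace.basisFun (Fin n) ℝ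
        (ofFinEmbEquiv.symm s i)))) =
      (((B.submatrix (Subtype.val : s.1 → Fin n) (Subtype.val : s.1 → Fin n)).submatrix
        (s.1.orderIsoOfFin s.2).toEquiv (s.1.orderIsoOfFin s.2).toEquiv).map
          (Int.cast : ℤ → ℝ))ᵀ := by
    ext i j
    simp [matrixCLM_apply]
    rfl
  rw [h2, Matrix.det_transpose]
  have h3 := (Int.castRingHom ℝ).map_det ((B.submatrix (Subtype.val : s.1 → Fin n)
    (Subtype.val : s.1 → Fin n)).submatrix (s.1.orderIsoOfFin s.2).toEquiv
      (s.1.orderIsoOfFin s.2).toEquiv)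
  have h4 := Matrix.det_submatrix_equiv_self (s.1.orderIsoOfFin s.2).toEquiv
    (B.submatrix (Subtype.val : s.1 → Fin n) (Subtype.val : s.1 → Fin n))
  rw [h4] at h3
  exact (congrArg (fun x : ℝ => (x : ℂ)) h3).symm.trans (by simp)

end ExteriorTrace

/-! ### The multiplicities of the eigenvalues as averages of traces -/

section Spectrum

variable {n p : ℕ} {μ : ℝ}

theorem orth_mulVec_mem_frequencies (q : QuarterIso n) {m : Fin n → ℤ}
    (hm : m ∈ frequencies n μ) : q.lin *ᵥ m ∈ frequencies n μ := by
  have h1 : (q.lin *ᵥ m) ⬝ᵥ (q.lin *ᵥ m) = m ⬝ᵥ m := by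
    rw [Matrix.dotProduct_mulVec, Matrix.vecMul_mulVec, q.orth', Matrix.vecMul_one]
  have h2 : ∀ k : Fin n → ℤ, ∑ i, (k i : ℝ) ^ 2 = ((k ⬝ᵥ k : ℤ) : ℝ) := fun k => by
    simp [dotProduct, sq]
  change 4 * Real.pi ^ 2 * ∑ i, ((q.lin *ᵥ m) i : ℝ) ^ 2 = μ
  rw [h2, h1, ← h2]
  exact hm

/-- The permutation of the frequencies of an eigenvalue given by the linear part of `q`. -/
def freqPerm (μ : ℝ) (q : QuarterIso n) : Equiv.Perm (frequencies n μ) where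
  toFun m := ⟨q.lin *ᵥ m.1, orth_mulVec_mem_frequencies q m.2⟩
  invFun m := ⟨q.linᵀ *ᵥ m.1, orth_mulVec_mem_frequencies q⁻¹ m.2⟩
  left_inv m := by
    ext1
    simp [Matrix.mulVec_mulVec, q.orth']
  right_inv m := by
    ext1
    simp [Matrix.mulVec_mulVec, q.orth]

/-- The phase `exp (2πi ⟨m, b⟩)` where `q` is the class of `x ↦ B (x + b)`. -/
def phase (q : QuarterIso n) (m : Fin n → ℤ) : ℂ :=
  ZMod.stdAddChar (∑ i, (m i : ZMod 4) * q.shift i)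

theorem planeWave_quarter {q : QuarterIso n} {b : Fin n → ℤ}
    (hb : ∀ i, (b i : ZMod 4) = q.shift i) (m : Fin n → ℤ) :
    planeWave m ((1 / 4 : ℝ) • intVec b) = phase q m := by
  have h : ∑ i, (m i : ZMod 4) * q.shift i = ((∑ i, m i * b i : ℤ) : ZMod 4) := by
    simp [hb]
  rw [phase, h, ZMod.stdAddChar_coe, planeWave]
  congr 1
  simp [intVec, Finset.mul_sum, Finset.sum_div]
  exact Finset.sum_congr rfl fun i _ => by ring

theorem phase_mul (q r : QuarterIso n) (m : Fin n → ℤ) :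
    phase (q * r) m = phase r m * phase q (r.lin *ᵥ m) := by
  rw [phase, phase, phase, ← AddChar.map_add_eq_mul]
  congr 1
  simp only [QuarterIso.mul_shift, Pi.add_apply, mul_add, Finset.sum_add_distrib]
  congr 1
  have h := Matrix.dotProduct_mulVec (fun i => (m i : ZMod 4))
    (r.linᵀ.map (Int.cast : ℤ → ZMod 4)) q.shift
  rw [Matrix.transpose_map, Matrix.vecMul_transpose, ← Matrix.transpose_map] at h
  refine h.trans (Finset.sum_congr rfl fun i _ => ?_)
  rw [← cast_mulVec r.lin m fun _ => rfl]

/-- The action of `q` on the coefficients of trigonometric polynomials that corresponds to the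
pull-back of forms. -/
def coeffPull (p : ℕ) (μ : ℝ) (q : QuarterIso n) :
    (frequencies n μ → Cov n p) →ₗ[ℂ] (frequencies n μ → Cov n p) where
  toFun c m := phase q m.1 • covPull p q.lin (c (freqPerm μ q m))
  map_add' c d := by
    funext m
    simp
  map_smul' a c := by
    funext m
    simp only [Pi.smul_apply, map_smul, RingHom.id_apply]
    exact smul_comm _ _ _

theorem coeffPull_apply (q : QuarterIso n) (c : frequencies n μ → Cov n p)
    (m : frequencies n μ) :
    coeffPull p μ q c m = phase q m.1 • covPull p q.lin (c (freqPerm μ q m)) := rfl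

theorem coeffPull_one : coeffPull (n := n) p μ 1 = 1 := by
  refine LinearMap.ext fun c => funext fun m => ?_
  have h : freqPerm μ 1 m = m := by
    ext1
    simp [freqPerm]
  simp [coeffPull_apply, h, phase, covPull_one]

theorem coeffPull_mul (q r : QuarterIso n) :
    coeffPull p μ (q * r) = coeffPull p μ r * coeffPull p μ q := by
  refine LinearMap.ext fun c => funext fun m => ?_
  have h : freqPerm μ (q * r) m = freqPerm μ q (freqPerm μ r m) := by
    ext1
    simp [freqPerm, Matrix.mulVec_mulVec]
  simp only [Module.End.mul_apply, coeffPull_apply, h, phase_mul, QuarterIso.mul_lin, covPull_mul,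
    map_smul, mul_smul]
  rfl

/-- The pull-back by an isometry of the class `q` maps plane waves to plane waves. -/
theorem pullback_synthesis {q : QuarterIso n} {g : Iso n} (hg : IsLift q g)
    (c : frequencies n μ → Cov n p) :
    pullback g (synthesis n (Cov n p) μ c) =
      synthesis n (Cov n p) μ (coeffPull p μ q c) := by
  obtain ⟨b, hb, rfl⟩ := hg
  funext x
  have h1 : pullback (rotTrans q.lin q.orth ((1 / 4 : ℝ) • intVec b))
      (synthesis n (Cov n p) μ c) x = covPull p q.lin (synthesis n (Cov n p) μ c
        (rotTrans q.lin q.orth ((1 / 4 : ℝ) • intVec b) x)) := rfl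
  have h2 : ∀ m y, planeWave (q.lin *ᵥ m)
      (rotTrans q.lin q.orth ((1 / 4 : ℝ) • intVec b) y) =
        phase q m * planeWave m y := fun m y => by
    rw [← planeWave_quarter hb, ← planeWave_add, rotTrans_apply]
    simp only [planeWave]
    congr 2
    have h3 : (fun i => (m i : ℝ)) ⬝ᵥ ((1 / 4 : ℝ) • intVec b + y).ofLp =
        (fun i => ((q.lin *ᵥ m) i : ℝ)) ⬝ᵥ
          (q.lin.map (Int.cast : ℤ → ℝ) *ᵥ ((1 / 4 : ℝ) • intVec b + y).ofLp) := by
      have h4 : (fun i => ((q.lin *ᵥ m) i : ℝ)) =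
          q.lin.map (Int.cast : ℤ → ℝ) *ᵥ fun i => (m i : ℝ) := by
        funext i
        simp [Matrix.mulVec, dotProduct]
      have h5 : (q.lin.map (Int.cast : ℤ → ℝ))ᵀ * q.lin.map (Int.cast : ℤ → ℝ) = 1 := by
        rw [← Matrix.transpose_map, ← Matrix.map_mul_intCast, q.orth']
        simp
      rw [h4, Matrix.dotProduct_mulVec, Matrix.vecMul_mulVec, h5, Matrix.vecMul_one]
    exact_mod_cast (congrArg (fun x : ℝ => (x : ℂ)) h3).symm
  rw [h1, synthesis_apply, synthesis_apply, map_sum, ← Equiv.sum_comp (freqPerm μ q)]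
  refine Finset.sum_congr rfl fun m _ => ?_
  rw [map_smul, coeffPull_apply, smul_smul, mul_comm, ← h2]
  rfl

variable {G : Type} [CommGroup G]

/-- The representation of a commutative group of classes of isometries on the coefficients of
trigonometric polynomials. Pull-back reverses products, which is harmless in a commutative group. -/
def coeffRep (p : ℕ) (μ : ℝ) (φ : G →* QuarterIso n) :
    Representation ℂ G (frequencies n μ → Cov n p) where
  toFun x := coeffPull p μ (φ x)
  map_one' := by rw [map_one, coeffPull_one]
  map_mul' x y := by rw [mul_comm, map_mul, coeffPull_mul]

/-- The eigenspaces of the Hodge Laplacian are the spaces of invariants of the point group on the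
coefficients. -/
theorem eigenspace_eq_map (φ : G →* QuarterIso n) :
    eigenspace (crystalGroup φ) p μ =
      (coeffRep p μ φ).invariants.map (synthesis n (Cov n p) μ) := by
  ext α
  constructor
  · rintro ⟨⟨hs, hi⟩, hα⟩
    rw [hodgeLaplacian_eq_flatLaplacian hs] at hα
    have hper : IsPeriodic α := fun m x => by
      have h := congrFun (hi _ (transl_intVec_mem φ m)) x
      have h1 : pullback (transl (intVec m)) α x = α (intVec m + x) := rfl
      rw [← h, h1, add_comm]
    obtain ⟨c, rfl⟩ := exists_synthesis_eq hs hper hα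
    refine ⟨c, fun x => ?_, rfl⟩
    obtain ⟨g, hg⟩ := exists_isLift (φ x)
    exact synthesis_injective μ ((pullback_synthesis hg c).symm.trans (hi g ⟨x, hg⟩))
  · rintro ⟨c, hc, rfl⟩
    refine ⟨⟨contDiff_synthesis c, ?_⟩, ?_⟩
    · rintro g ⟨x, hx⟩
      rw [pullback_synthesis hx]
      exact congrArg _ (hc x)
    · rw [hodgeLaplacian_eq_flatLaplacian (contDiff_synthesis c), flatLaplacian_synthesis]

theorem trace_pi_endomorphism {ι M : Type} [Fintype ι] [DecidableEq ι] [AddCommGroup M]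
    [Module ℂ M] [FiniteDimensional ℂ M] (f : (ι → M) →ₗ[ℂ] (ι → M)) :
    LinearMap.trace ℂ (ι → M) f =
      ∑ i, LinearMap.trace ℂ M (LinearMap.proj i ∘ₗ f ∘ₗ LinearMap.single ℂ (fun _ => M) i) := by
  let b := Module.finBasis ℂ M
  rw [LinearMap.trace_eq_matrix_trace ℂ (Pi.basis fun _ : ι => b), Matrix.trace, Fintype.sum_sigma]
  refine Finset.sum_congr rfl fun i _ => ?_
  rw [LinearMap.trace_eq_matrix_trace ℂ b, Matrix.trace]
  refine Finset.sum_congr rfl fun j _ => ?_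
  simp only [Matrix.diag_apply, LinearMap.toMatrix_apply, Pi.basis_apply, Pi.basis_repr]
  rfl

/-- The sum of the phases of `q` over the frequencies fixed by its linear part. -/
def phaseSum (μ : ℝ) (q : QuarterIso n) : ℂ :=
  ∑ m : frequencies n μ, if q.lin *ᵥ m.1 = m.1 then phase q m.1 else 0

theorem trace_coeffPull (q : QuarterIso n) :
    LinearMap.trace ℂ _ (coeffPull p μ q) = phaseSum μ q * extTrace p q.lin := by
  classical
  rw [trace_pi_endomorphism, phaseSum, Finset.sum_mul]
  refine Finset.sum_congr rfl fun m _ => ?_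
  by_cases h : q.lin *ᵥ m.1 = m.1
  · have h1 : LinearMap.proj m ∘ₗ coeffPull p μ q ∘ₗ LinearMap.single ℂ (fun _ => Cov n p) m =
        phase q m.1 • covPull p q.lin := by
      have h2 : freqPerm μ q m = m := Subtype.ext h
      ext1 α
      simp [coeffPull_apply, h2]
    rw [h1, if_pos h, map_smul]
    rfl
  · have h1 : LinearMap.proj m ∘ₗ coeffPull p μ q ∘ₗ LinearMap.single ℂ (fun _ => Cov n p) m =
        0 := by
      have h2 : freqPerm μ q m ≠ m := fun h3 => h (congrArg Subtype.val h3)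
      ext1 α
      simp only [LinearMap.comp_apply, LinearMap.proj_apply, coeffPull_apply,
        LinearMap.single_apply, Pi.single_eq_of_ne h2, map_zero]
      exact smul_zero (A := Cov n p) (phase q m.1)
    rw [h1, if_neg h, map_zero, zero_mul]

theorem trace_coeffPull_conj (q u : QuarterIso n) :
    LinearMap.trace ℂ _ (coeffPull p μ (u * q * u⁻¹)) = LinearMap.trace ℂ _ (coeffPull p μ q) := by
  rw [coeffPull_mul, coeffPull_mul, LinearMap.trace_mul_comm, mul_assoc, ← coeffPull_mul,
    inv_mul_cancel, coeffPull_one, mul_one]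

theorem rank_eigenspace [Finite G] (φ : G →* QuarterIso n) :
    Module.rank ℂ (eigenspace (crystalGroup φ) p μ) =
      (Module.finrank ℂ (coeffRep p μ φ).invariants : Cardinal) := by
  rw [eigenspace_eq_map, ← (Submodule.equivMapOfInjective _ (synthesis_injective μ) _).rank_eq,
    Module.finrank_eq_rank]

theorem card_mul_finrank_invariants {V : Type} [AddCommGroup V] [Module ℂ V]
    [FiniteDimensional ℂ V] [Fintype G] (ρ : Representation ℂ G V) :
    (Fintype.card G : ℂ) * (Module.finrank ℂ ρ.invariants : ℂ) =
      ∑ x, LinearMap.trace ℂ V (ρ x) := by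
  have : Invertible (Fintype.card G : ℂ) :=
    invertibleOfNonzero (Nat.cast_ne_zero.2 Fintype.card_ne_zero)
  rw [← (Representation.isProj_averageMap ρ).trace]
  simp only [Representation.averageMap, GroupAlgebra.average, map_smul, map_sum]
  rw [smul_eq_mul, mul_invOf_cancel_left]
  refine Finset.sum_congr rfl fun x _ => ?_
  congr 1
  simp

theorem card_mul_finrank_coeffRep [Fintype G] (φ : G →* QuarterIso n) :
    (Fintype.card G : ℂ) * (Module.finrank ℂ (coeffRep p μ φ).invariants : ℂ) =
      ∑ x, LinearMap.trace ℂ _ (coeffPull p μ (φ x)) :=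
  card_mul_finrank_invariants (coeffRep p μ φ)

/-- Two quotients by groups with isomorphic point groups are isospectral on `p`-forms if and only
if the traces of the point groups have the same sum for all eigenvalues. -/
theorem isospectral_iff {H : Type} [CommGroup H] [Fintype G] [Fintype H]
    (hc : Fintype.card G = Fintype.card H) (φ : G →* QuarterIso n) (ψ : H →* QuarterIso n) :
    Isospectral (crystalGroup φ) (crystalGroup ψ) p ↔ ∀ μ,
      ∑ x, LinearMap.trace ℂ _ (coeffPull p μ (φ x)) =
        ∑ x, LinearMap.trace ℂ _ (coeffPull p μ (ψ x)) := by
  refine forall_congr' fun μ => ?_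
  rw [rank_eigenspace, rank_eigenspace, ← card_mul_finrank_coeffRep,
    ← card_mul_finrank_coeffRep, hc, Nat.cast_inj,
    mul_right_inj' (Nat.cast_ne_zero.2 Fintype.card_ne_zero), Nat.cast_inj]

end Spectrum

/-! ### Discreteness, compactness, torsion and holonomy -/

/-- The isometries of the class `q` translate the `i`-th coordinate by a constant that is nonzero
modulo `1`. -/
def QuarterIso.MovesCoord {n : ℕ} (q : QuarterIso n) (i : Fin n) : Prop :=
  (∀ j, q.lin i j = if i = j then 1 else 0) ∧ q.shift i ≠ 0

instance {n : ℕ} (q : QuarterIso n) (i : Fin n) : Decidable (q.MovesCoord i) :=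
  inferInstanceAs (Decidable ((∀ j, q.lin i j = if i = j then 1 else 0) ∧ q.shift i ≠ 0))

section Bieberbach

variable {n : ℕ} {q : QuarterIso n} {g h : Iso n}

theorem IsLift.map_quarter (hg : IsLift q g) (k : Fin n → ℤ) :
    ∃ l, g ((1 / 4 : ℝ) • intVec k) = (1 / 4 : ℝ) • intVec l := by
  obtain ⟨b, -, rfl⟩ := hg
  refine ⟨q.lin *ᵥ (b + k), ?_⟩
  rw [rotTrans_apply, intVec_mulVec, intVec_add]
  ext i
  simp [Matrix.mulVec_add, Matrix.mulVec_smul]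

theorem quarter_eq_of_dist_lt {k l : Fin n → ℤ}
    (h : dist ((1 / 4 : ℝ) • intVec k) ((1 / 4 : ℝ) • intVec l) < 1 / 4) : k = l := by
  funext i
  have h1 := PiLp.norm_apply_le ((1 / 4 : ℝ) • intVec k - (1 / 4 : ℝ) • intVec l) i
  rw [← dist_eq_norm, Real.norm_eq_abs] at h1
  have h2 : ((1 / 4 : ℝ) • intVec k - (1 / 4 : ℝ) • intVec l) i = ((k i - l i : ℤ) : ℝ) / 4 := by
    simp [intVec]
    ring
  rw [h2, abs_div, abs_of_pos (show (0 : ℝ) < 4 by norm_num)] at h1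
  have h3 : |((k i - l i : ℤ) : ℝ)| < 1 := by linarith
  have h4 : |k i - l i| < 1 := by exact_mod_cast h3
  exact sub_eq_zero.1 (Int.abs_lt_one_iff.1 h4)

/-- The origin and the standard basis vectors, multiplied by `4`. -/
def framePoint : Option (Fin n) → Fin n → ℤ
  | none => 0
  | some i => Pi.single i 4

theorem eq_of_framePoint
    (H : ∀ o, g ((1 / 4 : ℝ) • intVec (framePoint o)) = h ((1 / 4 : ℝ) • intVec (framePoint o))) :
    g = h := by
  have h0 : (1 / 4 : ℝ) • intVec (framePoint (n := n) none) = 0 := by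
    ext i
    simp [intVec, framePoint]
  have h1 : ∀ i, (1 / 4 : ℝ) • intVec (framePoint (some i)) =
      EuclideanSpace.basisFun (Fin n) ℝ i := fun i => by
    ext j
    by_cases hj : j = i
    · subst hj
      simp [intVec, framePoint]
    · simp [intVec, framePoint, hj]
  have h2 : g 0 = h 0 := by simpa only [h0] using H none
  have h3 : ∀ (f : Iso n) v, f v = f.linearIsometryEquiv v + f 0 := fun f v => by
    simpa using f.map_vadd 0 v
  have h4 : g.linearIsometryEquiv.toLinearEquiv.toLinearMap =
      h.linearIsometryEquiv.toLinearEquiv.toLinearMap := by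
    refine (EuclideanSpace.basisFun (Fin n) ℝ).toBasis.ext fun i => ?_
    have := H (some i)
    rw [h1, h3 g, h3 h, h2] at this
    simpa using this
  ext1 v
  rw [h3 g, h3 h, h2]
  congr 1
  exact LinearMap.congr_fun h4 v

variable {G : Type} [Group G] (φ : G →* QuarterIso n)

/-- The orbits of the quarter lattice points under the group stay in the quarter lattice, so that an
isometry in the group is isolated by its values at the frame points. -/
theorem discreteTopology_crystalGroup :
    DiscreteTopology ↥(toContMap '' (crystalGroup φ : Set (Iso n))) := by
  rw [discreteTopology_iff_isOpen_singleton]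
  rintro ⟨_, g, ⟨x, hg⟩, rfl⟩
  have ho : IsOpen (⋂ o : Option (Fin n), {f : C(E n, E n) |
      dist (f ((1 / 4 : ℝ) • intVec (framePoint o)))
        (g ((1 / 4 : ℝ) • intVec (framePoint o))) < 1 / 4}) :=
    isOpen_iInter_of_finite fun o =>
      isOpen_lt ((continuous_eval_const _).dist continuous_const) continuous_const
  convert ho.preimage continuous_subtype_val
  ext ⟨f, h, ⟨y, hh⟩, rfl⟩
  simp only [Set.mem_singleton_iff, Set.mem_preimage, Set.mem_iInter, Set.mem_ofPred_eq]
  constructor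
  · intro e o
    have e' : toContMap h = toContMap g := congrArg Subtype.val e
    rw [e']
    change dist (g _) (g _) < 1 / 4
    simp
  · intro H
    refine Subtype.ext (congrArg toContMap (eq_of_framePoint fun o => ?_))
    obtain ⟨k, hk⟩ := hg.map_quarter (framePoint o)
    obtain ⟨l, hl⟩ := hh.map_quarter (framePoint o)
    have h1 : dist (h ((1 / 4 : ℝ) • intVec (framePoint o)))
        (g ((1 / 4 : ℝ) • intVec (framePoint o))) < 1 / 4 := H o
    rw [hk, hl] at h1 ⊢
    rw [quarter_eq_of_dist_lt h1]

theorem compactSpace_crystalGroup : CompactSpace (FlatQuotient (crystalGroup φ)) := by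
  let K : Set (E n) := WithLp.toLp 2 '' Set.pi Set.univ fun _ : Fin n => Set.Icc (0 : ℝ) 1
  have hK : IsCompact K :=
    (isCompact_univ_pi fun _ => isCompact_Icc).image (PiLp.continuous_toLp 2 _)
  have hs : (Quotient.mk (orbitSetoid (crystalGroup φ))) '' K = Set.univ := by
    refine Set.eq_univ_of_forall fun y => ?_
    induction y using Quotient.inductionOn with
    | _ x =>
      refine ⟨intVec (fun i => -⌊x i⌋) + x,
        ⟨(intVec (fun i => -⌊x i⌋) + x).ofLp, fun i _ => ?_, rfl⟩, ?_⟩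
      · have h1 := Int.floor_le (x i)
        have h2 := Int.lt_floor_add_one (x i)
        simp only [PiLp.add_apply, intVec, Set.mem_Icc]
        push_cast
        constructor <;> linarith
      · refine Quotient.sound ((orbitSetoid (crystalGroup φ)).symm
          ⟨_, transl_intVec_mem φ _, rfl⟩)
  exact ⟨by rw [← hs]; exact hK.image continuous_quotient_mk'⟩

theorem eq_zero_of_pow_eq_one {i : Fin n} {s : ℝ} (hs : ∀ y, g y i = y i + s) {k : ℕ} (hk : 0 < k)
    (h : g ^ k = 1) : s = 0 := by
  have h1 : ∀ (j : ℕ) y, (g ^ j) y i = y i + j * s := fun j => by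
    induction j with
    | zero => simp
    | succ j ih =>
      intro y
      rw [pow_succ', AffineIsometryEquiv.coe_mul, Function.comp_apply, hs, ih]
      push_cast
      ring
  have h2 := h1 k 0
  rw [h] at h2
  simp at h2
  exact h2.resolve_left hk.ne'

/-- An isometry that translates a coordinate by a nonzero constant has infinite order. -/
theorem torsionFree_crystalGroup
    (hφ : ∀ x, x ≠ 1 → ∃ i, (φ x).MovesCoord i) :
    ∀ g ∈ crystalGroup φ, ∀ k : ℕ, 0 < k → g ^ k = 1 → g = 1 := by
  rintro g ⟨x, hx⟩ k hk h
  by_cases h1 : x = 1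
  · rw [h1, map_one, isLift_one_iff] at hx
    obtain ⟨m, rfl⟩ := hx
    have h2 : intVec m = 0 := by
      ext i
      refine eq_zero_of_pow_eq_one (i := i) (s := intVec m i) (fun y => ?_) hk h
      rw [transl_apply, PiLp.add_apply, add_comm]
    rw [h2]
    ext1 y
    rw [transl_apply, zero_add]
    rfl
  · exfalso
    obtain ⟨i, hi, hi'⟩ := hφ x h1
    obtain ⟨b, hb, rfl⟩ := hx
    have h2 := eq_zero_of_pow_eq_one (i := i) (s := (b i : ℝ) / 4) (fun y => ?_) hk h
    · have h3 : b i = 0 := by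
        have : (b i : ℝ) = 0 := by linarith
        exact_mod_cast this
      exact hi' (by rw [← hb, h3, Int.cast_zero])
    · rw [rotTrans_apply]
      simp only [Matrix.mulVec, dotProduct, Matrix.map_apply, hi]
      rw [Finset.sum_eq_single i]
      · simp [intVec]
        ring
      · intro j _ hj
        simp [hj.symm]
      · simp

theorem isBieberbach_crystalGroup
    (hφ : ∀ x, x ≠ 1 → ∃ i, (φ x).MovesCoord i) :
    IsBieberbach (crystalGroup φ) :=
  ⟨discreteTopology_crystalGroup φ, compactSpace_crystalGroup φ, torsionFree_crystalGroup φ hφ⟩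

/-- The linear isometries given by the point group. -/
def pointHom : G →* (E n ≃ₗᵢ[ℝ] E n) where
  toFun x := matrixIso (φ x).lin (φ x).orth
  map_one' := by
    ext1 v
    change WithLp.toLp 2 (((φ 1).lin.map (Int.cast : ℤ → ℝ)) *ᵥ v.ofLp) = v
    simp
  map_mul' x y := by
    ext1 v
    change WithLp.toLp 2 (((φ (x * y)).lin.map (Int.cast : ℤ → ℝ)) *ᵥ v.ofLp) =
      WithLp.toLp 2 (((φ x).lin.map (Int.cast : ℤ → ℝ)) *ᵥ
        (((φ y).lin.map (Int.cast : ℤ → ℝ)) *ᵥ v.ofLp))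
    rw [map_mul, QuarterIso.mul_lin, Matrix.map_mul_intCast, Matrix.mulVec_mulVec]

theorem range_pointHom : (pointHom φ).range = holonomy (crystalGroup φ) := by
  ext A
  constructor
  · rintro ⟨x, rfl⟩
    obtain ⟨g, hg⟩ := exists_isLift (φ x)
    exact ⟨g, ⟨x, hg⟩, isLift_linearPart hg⟩
  · rintro ⟨g, ⟨x, hx⟩, rfl⟩
    exact ⟨x, (isLift_linearPart hx).symm⟩

theorem nonempty_holonomy_mulEquiv (hφ : ∀ x, (φ x).lin = 1 → x = 1) :
    Nonempty (holonomy (crystalGroup φ) ≃* G) := by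
  have hi : Function.Injective (pointHom φ) := by
    rw [injective_iff_map_eq_one]
    refine fun x h => hφ x ?_
    ext i j
    have h1 := congrArg (fun A : E n ≃ₗᵢ[ℝ] E n => A (EuclideanSpace.single j 1) i) h
    change (((φ x).lin.map (Int.cast : ℤ → ℝ)) *ᵥ Pi.single j 1) i =
      (Pi.single j 1 : Fin n → ℝ) i at h1
    have h2 : (((φ x).lin i j : ℤ) : ℝ) = (((1 : Matrix (Fin n) (Fin n) ℤ) i j : ℤ) : ℝ) := by
      simpa [Matrix.one_apply, Pi.single_apply] using h1
    exact_mod_cast h2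
  exact ⟨((MonoidHom.ofInjective hi).trans (MulEquiv.subgroupCongr (range_pointHom φ))).symm⟩

end Bieberbach

/-! ### Orientability -/

section Orientability

variable {n : ℕ}

/-- The standard volume form on `ℝⁿ`. -/
def volForm (n : ℕ) : E n [⋀^Fin n]→L[ℝ] ℝ where
  toMultilinearMap := (EuclideanSpace.basisFun (Fin n) ℝ).toBasis.det.toMultilinearMap
  cont := by
    change Continuous fun v => (EuclideanSpace.basisFun (Fin n) ℝ).toBasis.det v
    simp only [Module.Basis.det_apply]
    refine Continuous.matrix_det (continuous_matrix fun i j => ?_)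
    simp only [Module.Basis.toMatrix_apply, OrthonormalBasis.coe_toBasis_repr_apply,
      EuclideanSpace.basisFun_repr]
    fun_prop
  map_eq_zero_of_eq' := (EuclideanSpace.basisFun (Fin n) ℝ).toBasis.det.map_eq_zero_of_eq'

theorem volForm_apply (v : Fin n → E n) : volForm n v = (Matrix.of fun i j => v j i).det := by
  change (EuclideanSpace.basisFun (Fin n) ℝ).toBasis.det v = _
  rw [Module.Basis.det_apply]
  rfl

theorem volForm_matrixIso (B : Matrix (Fin n) (Fin n) ℤ) (hB : B * Bᵀ = 1) (v : Fin n → E n) :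
    volForm n (fun i => matrixIso B hB (v i)) = B.det * volForm n v := by
  rw [volForm_apply, volForm_apply]
  have h1 : (Matrix.of fun i j => (matrixIso B hB (v j)) i) =
      (Int.castRingHom ℝ).mapMatrix B * Matrix.of fun i j => v j i := by
    ext i j
    rfl
  rw [h1, Matrix.det_mul, ← RingHom.map_det]
  rfl

theorem volForm_basisFun : volForm n ⇑(EuclideanSpace.basisFun (Fin n) ℝ) = 1 := by
  have h := (EuclideanSpace.basisFun (Fin n) ℝ).toBasis.det_self
  rw [OrthonormalBasis.coe_toBasis] at h
  exact h

/-- Every `n`-covector on `ℝⁿ` is a multiple of the volume form. -/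
theorem eq_smul_volForm (β : E n [⋀^Fin n]→L[ℝ] ℝ) :
    β = β (EuclideanSpace.basisFun (Fin n) ℝ) • volForm n := by
  have h := β.toAlternatingMap.eq_smul_basis_det (EuclideanSpace.basisFun (Fin n) ℝ).toBasis
  ext v
  have h1 := DFunLike.congr_fun h v
  rw [OrthonormalBasis.coe_toBasis] at h1
  exact h1

variable {G : Type} [Group G] (φ : G →* QuarterIso n)

theorem isOrientable_crystalGroup (hφ : ∀ x, (φ x).lin.det = 1) :
    IsOrientable (crystalGroup φ) := by
  refine ⟨fun _ => volForm n, ⟨contDiff_const, ?_⟩, fun x h => ?_⟩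
  · rintro g ⟨x, b, -, rfl⟩
    funext y
    ext v
    refine (volForm_matrixIso (φ x).lin (φ x).orth v).trans ?_
    rw [hφ]
    simp
  · have h1 := DFunLike.congr_fun h ⇑(EuclideanSpace.basisFun (Fin n) ℝ)
    rw [volForm_basisFun] at h1
    exact one_ne_zero h1

theorem not_isOrientable_crystalGroup {x : G} (hx : (φ x).lin.det = -1) :
    ¬ IsOrientable (crystalGroup φ) := by
  rintro ⟨α, ⟨hs, hi⟩, hα⟩
  obtain ⟨g, hg⟩ := exists_isLift (φ x)
  let f : E n → ℝ := fun y => α y (EuclideanSpace.basisFun (Fin n) ℝ)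
  have hf : Continuous f := by
    exact (continuous_eval_const _).comp hs.continuous
  have h0 : ∀ y, f y ≠ 0 := fun y h => hα y (by
    rw [eq_smul_volForm (α y)]
    change f y • volForm n = 0
    rw [h, zero_smul])
  have hneg : ∀ y, f y = -f (g y) := fun y => by
    have h1 := DFunLike.congr_fun (congrFun (hi g ⟨x, hg⟩) y) ⇑(EuclideanSpace.basisFun (Fin n) ℝ)
    obtain ⟨b, -, rfl⟩ := hg
    change α y (EuclideanSpace.basisFun (Fin n) ℝ) = _
    rw [← h1]
    change α _ (fun i => matrixIso (φ x).lin (φ x).orth (EuclideanSpace.basisFun (Fin n) ℝ i)) = _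
    rw [eq_smul_volForm (α _), ContinuousAlternatingMap.smul_apply, volForm_matrixIso, hx]
    rw [volForm_basisFun]
    simp [f]
  obtain ⟨y, hy⟩ : (0 : ℝ) ∈ Set.range f := by
    rcases le_total (f 0) 0 with h | h
    · exact mem_range_of_exists_le_of_exists_ge hf ⟨0, h⟩ ⟨g 0, by linarith [hneg 0]⟩
    · exact mem_range_of_exists_le_of_exists_ge hf ⟨g 0, by linarith [hneg 0]⟩ ⟨0, h⟩
  exact h0 y hy

end Orientability

/-! ### Point groups isomorphic to `ℤ₄ × ℤ₂` -/

/-- The point group `ℤ₄ × ℤ₂`, written multiplicatively. -/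
abbrev PointGroup : Type := Multiplicative (ZMod 4 × ZMod 2)

/-- The homomorphism from `ℤ₄ × ℤ₂` given by commuting elements `a`, `b` with `a⁴ = b² = 1`. -/
def pairHom {H : Type} [Group H] (a b : H) (ha : a ^ 4 = 1) (hb : b ^ 2 = 1) (hab : Commute a b) :
    PointGroup →* H where
  toFun x := a ^ x.toAdd.1.val * b ^ x.toAdd.2.val
  map_one' := by simp
  map_mul' x y := by
    have h1 : a ^ (x.toAdd.1 + y.toAdd.1).val = a ^ x.toAdd.1.val * a ^ y.toAdd.1.val := by
      rw [ZMod.val_add, ← pow_eq_pow_mod _ ha, pow_add]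
    have h2 : b ^ (x.toAdd.2 + y.toAdd.2).val = b ^ x.toAdd.2.val * b ^ y.toAdd.2.val := by
      rw [ZMod.val_add, ← pow_eq_pow_mod _ hb, pow_add]
    rw [toAdd_mul, Prod.fst_add, Prod.snd_add, h1, h2, mul_assoc, mul_assoc,
      ← mul_assoc (b ^ _), ← ((hab.pow_pow _ _).eq), mul_assoc]

section PairHom

variable {H : Type} [Group H] {a b : H} (ha : a ^ 4 = 1) (hb : b ^ 2 = 1) (hab : Commute a b)

theorem pairHom_apply (x : PointGroup) :
    pairHom a b ha hb hab x = a ^ x.toAdd.1.val * b ^ x.toAdd.2.val := rfl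

theorem sum_pairHom {R : Type} [AddCommMonoid R] (f : H → R) :
    ∑ x, f (pairHom a b ha hb hab x) =
      (f 1 + f b) + (f a + f (a * b)) + (f (a ^ 2) + f (a ^ 2 * b)) +
        (f (a ^ 3) + f (a ^ 3 * b)) := by
  have h1 : ∑ x, f (pairHom a b ha hb hab x) =
      ∑ x : Fin 4 × Fin 2, f (a ^ (x.1 : ℕ) * b ^ (x.2 : ℕ)) := rfl
  rw [h1, Fintype.sum_prod_type]
  simp [Fin.sum_univ_four, Fin.sum_univ_two]

theorem closure_eq_crystalGroup {n : ℕ} {a b : QuarterIso n} (ha : a ^ 4 = 1) (hb : b ^ 2 = 1)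
    (hab : Commute a b) {g h : Iso n} (hg : IsLift a g) (hh : IsLift b h) :
    Subgroup.closure ({g, h} ∪ latticeTranslations n) =
      crystalGroup (pairHom a b ha hb hab) := by
  apply le_antisymm
  · rw [Subgroup.closure_le]
    rintro k ((rfl | rfl) | ⟨m, rfl⟩)
    · refine ⟨Multiplicative.ofAdd (1, 0), ?_⟩
      have : pairHom a b ha hb hab (Multiplicative.ofAdd (1, 0)) = a := by
        change a ^ 1 * b ^ 0 = a
        simp
      rwa [this]
    · refine ⟨Multiplicative.ofAdd (0, 1), ?_⟩
      have : pairHom a b ha hb hab (Multiplicative.ofAdd (0, 1)) = b := by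
        change a ^ 0 * b ^ 1 = b
        simp
      rwa [this]
    · exact transl_intVec_mem _ m
  · rintro k ⟨x, hx⟩
    have hpow : ∀ {q : QuarterIso n} {f : Iso n} (j : ℕ), IsLift q f → IsLift (q ^ j) (f ^ j) := by
      intro q f j hf
      induction j with
      | zero => exact isLift_one_iff.2 ⟨0, by ext1 x; simp [transl, intVec]; rfl⟩
      | succ j ih =>
        rw [pow_succ, pow_succ]
        exact ih.mul hf
    have h1 : IsLift (pairHom a b ha hb hab x) (g ^ x.toAdd.1.val * h ^ x.toAdd.2.val) :=
      (hpow _ hg).mul (hpow _ hh)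
    have h2 := h1.inv.mul hx
    rw [inv_mul_cancel, isLift_one_iff] at h2
    obtain ⟨m, hm⟩ := h2
    rw [inv_mul_eq_iff_eq_mul] at hm
    rw [hm]
    have hmem : ∀ f ∈ ({g, h} ∪ latticeTranslations n : Set (Iso n)),
        f ∈ Subgroup.closure ({g, h} ∪ latticeTranslations n) := fun f hf =>
      Subgroup.subset_closure hf
    refine mul_mem (mul_mem (pow_mem (hmem g ?_) _) (pow_mem (hmem h ?_) _)) (hmem _ ?_)
    · simp
    · simp
    · exact Or.inr ⟨m, rfl⟩

end PairHom

/-! ### The point groups of `Γ` and `Γ'` -/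

/-- The class of `B₁ L_{e₅/4}`. -/
def q₁ : QuarterIso 8 := ⟨B₁, hB₁, Pi.single 4 1⟩

/-- The class of `B₂ L_{e₆/2}`. -/
def q₂ : QuarterIso 8 := ⟨B₂, hB₂, Pi.single 5 2⟩

/-- The class of `B₁' L_{e₆/4}`. -/
def q₁' : QuarterIso 8 := ⟨B₁', hB₁', Pi.single 5 1⟩

/-- The class of `B₂' L_{(e₄+e₅)/2}`. -/
def q₂' : QuarterIso 8 := ⟨B₂', hB₂', Pi.single 3 2 + Pi.single 4 2⟩

theorem isLift_q₁ : IsLift q₁ (rotTrans B₁ hB₁ ((1 / 4 : ℝ) • e 4)) := by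
  refine ⟨Pi.single 4 1, by decide +kernel, ?_⟩
  change _ = rotTrans B₁ hB₁ _
  congr 1
  ext i
  fin_cases i <;> simp [intVec, e]

theorem isLift_q₂ : IsLift q₂ (rotTrans B₂ hB₂ ((1 / 2 : ℝ) • e 5)) := by
  refine ⟨Pi.single 5 2, by decide +kernel, ?_⟩
  change _ = rotTrans B₂ hB₂ _
  congr 1
  ext i
  fin_cases i <;> simp [intVec, e]
  norm_num

theorem isLift_q₁' : IsLift q₁' (rotTrans B₁' hB₁' ((1 / 4 : ℝ) • e 5)) := by
  refine ⟨Pi.single 5 1, by decide +kernel, ?_⟩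
  change _ = rotTrans B₁' hB₁' _
  congr 1
  ext i
  fin_cases i <;> simp [intVec, e]

theorem isLift_q₂' : IsLift q₂' (rotTrans B₂' hB₂' ((1 / 2 : ℝ) • (e 3 + e 4))) := by
  refine ⟨Pi.single 3 2 + Pi.single 4 2, by decide +kernel, ?_⟩
  change _ = rotTrans B₂' hB₂' _
  congr 1
  ext i
  fin_cases i <;> simp [intVec, e] <;> norm_num

theorem q₁_pow_four : q₁ ^ 4 = 1 := by
  ext1 <;> decide +kernel

theorem q₂_sq : q₂ ^ 2 = 1 := by
  ext1 <;> decide +kernel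

theorem commute_q₁_q₂ : Commute q₁ q₂ := by
  refine QuarterIso.ext ?_ ?_ <;> decide +kernel

theorem q₁'_pow_four : q₁' ^ 4 = 1 := by
  ext1 <;> decide +kernel

theorem q₂'_sq : q₂' ^ 2 = 1 := by
  ext1 <;> decide +kernel

theorem commute_q₁'_q₂' : Commute q₁' q₂' := by
  refine QuarterIso.ext ?_ ?_ <;> decide +kernel

/-- The point group of `Γ`. -/
def φ₈ : PointGroup →* QuarterIso 8 := pairHom q₁ q₂ q₁_pow_four q₂_sq commute_q₁_q₂

/-- The point group of `Γ'`. -/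
def φ₈' : PointGroup →* QuarterIso 8 := pairHom q₁' q₂' q₁'_pow_four q₂'_sq commute_q₁'_q₂'

theorem Γ₈_eq : Γ₈ = crystalGroup φ₈ := closure_eq_crystalGroup _ _ _ isLift_q₁ isLift_q₂

theorem Γ₈'_eq : Γ₈' = crystalGroup φ₈' := closure_eq_crystalGroup _ _ _ isLift_q₁' isLift_q₂'

theorem φ₈_moves : ∀ x, x ≠ 1 → ∃ i, (φ₈ x).MovesCoord i := by
  decide +kernel

theorem φ₈'_moves : ∀ x, x ≠ 1 → ∃ i, (φ₈' x).MovesCoord i := by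
  decide +kernel

theorem φ₈_faithful : ∀ x, (φ₈ x).lin = 1 → x = 1 := by
  decide +kernel

theorem φ₈'_faithful : ∀ x, (φ₈' x).lin = 1 → x = 1 := by
  decide +kernel


/-! ### Determinants -/

section Determinants

open Polynomial

/-- The polynomial `det (1 + X B)`. -/
def detPoly {m : Type} [Fintype m] [DecidableEq m] (B : Matrix m m ℤ) : ℤ[X] :=
  (1 + (X : ℤ[X]) • B.map C).det

theorem detPoly_submatrix {m k : Type} [Fintype m] [DecidableEq m] [Fintype k] [DecidableEq k]
    (f : m ≃ k) (B : Matrix k k ℤ) : detPoly (B.submatrix f f) = detPoly B := by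
  rw [detPoly, detPoly, ← Matrix.det_submatrix_equiv_self f]
  congr 1
  ext1 i j
  simp [Matrix.one_apply]

theorem detPoly_fromBlocks {m k : Type} [Fintype m] [DecidableEq m] [Fintype k] [DecidableEq k]
    (A : Matrix m m ℤ) (D : Matrix k k ℤ) :
    detPoly (Matrix.fromBlocks A 0 0 D) = detPoly A * detPoly D := by
  rw [detPoly, Matrix.fromBlocks_map, ← Matrix.fromBlocks_one, Matrix.fromBlocks_smul,
    Matrix.fromBlocks_add]
  simp only [Matrix.map_zero C (map_zero C), smul_zero, add_zero]
  rw [Matrix.det_fromBlocks_zero₂₁]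
  rfl

theorem detPoly_diagonal {m : Type} [Fintype m] [DecidableEq m] (d : m → ℤ) :
    detPoly (Matrix.diagonal d) = ∏ i, (1 + X * C (d i)) := by
  rw [detPoly, ← Matrix.det_diagonal]
  congr 1
  ext1 i j
  by_cases h : i = j
  · subst h
    simp
  · simp [h]

/-- The rotation block `J̃`. -/
def rotBlock : Matrix (Fin 2) (Fin 2) ℤ := !![0, 1; -1, 0]

theorem detPoly_rotBlock : detPoly rotBlock = 1 + X ^ 2 := by
  simp [detPoly, rotBlock, Matrix.det_fin_two]
  ring

theorem B₁_eq_blocks : B₁ = (Matrix.fromBlocks rotBlock 0 0 ((Matrix.fromBlocks rotBlock 0 0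
      (Matrix.diagonal ![1, 1, -1, -1])).submatrix (finSumFinEquiv (m := 2) (n := 4)).symm
        (finSumFinEquiv (m := 2) (n := 4)).symm)).submatrix
    (finSumFinEquiv (m := 2) (n := 6)).symm (finSumFinEquiv (m := 2) (n := 6)).symm := by
  decide +kernel

theorem B₁'_eq_blocks : B₁' = (Matrix.fromBlocks rotBlock 0 0
      (Matrix.diagonal ![1, -1, -1, 1, -1, 1])).submatrix
    (finSumFinEquiv (m := 2) (n := 6)).symm (finSumFinEquiv (m := 2) (n := 6)).symm := by
  decide +kernel

theorem detPoly_B₁ : detPoly B₁ = 1 - 2 * X ^ 4 + X ^ 8 := by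
  rw [B₁_eq_blocks, detPoly_submatrix, detPoly_fromBlocks, detPoly_submatrix, detPoly_fromBlocks,
    detPoly_rotBlock, detPoly_diagonal]
  simp [Fin.prod_univ_succ]
  ring

theorem detPoly_B₁' : detPoly B₁' = 1 - 2 * X ^ 2 + 2 * X ^ 6 - X ^ 8 := by
  rw [B₁'_eq_blocks, detPoly_submatrix, detPoly_fromBlocks, detPoly_rotBlock, detPoly_diagonal]
  simp [Fin.prod_univ_succ]
  ring

theorem coeff_detPoly_ne {p : ℕ} (hp : p ≤ 8) (h : Even p) (h0 : p ≠ 0) :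
    (detPoly B₁).coeff p ≠ (detPoly B₁').coeff p := by
  have h2 : (2 : ℤ[X]) = C 2 := rfl
  rw [detPoly_B₁, detPoly_B₁', h2]
  simp only [coeff_add, coeff_sub, coeff_one, coeff_C_mul, coeff_X_pow]
  interval_cases p <;> first | exact absurd rfl h0 | exact absurd h (by decide) | norm_num

theorem coeff_zero_detPoly {m : Type} [Fintype m] [DecidableEq m] (B : Matrix m m ℤ) :
    (detPoly B).coeff 0 = 1 := by
  rw [detPoly, Matrix.det_one_add_X_smul]
  simp

theorem det_B₁ : B₁.det = 1 := by
  rw [B₁_eq_blocks, Matrix.det_submatrix_equiv_self, Matrix.det_fromBlocks_zero₂₁,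
    Matrix.det_submatrix_equiv_self, Matrix.det_fromBlocks_zero₂₁, Matrix.det_diagonal]
  simp [rotBlock, Matrix.det_fin_two, Fin.prod_univ_succ]

theorem det_B₁' : B₁'.det = -1 := by
  rw [B₁'_eq_blocks, Matrix.det_submatrix_equiv_self, Matrix.det_fromBlocks_zero₂₁,
    Matrix.det_diagonal]
  simp [rotBlock, Matrix.det_fin_two, Fin.prod_univ_succ]

theorem det_B₂ : B₂.det = 1 := by
  rw [B₂, Matrix.det_diagonal]
  simp [Fin.prod_univ_succ]

end Determinants

theorem isOrientable_Γ₈ : IsOrientable Γ₈ := by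
  rw [Γ₈_eq]
  refine isOrientable_crystalGroup φ₈ fun x => ?_
  rw [φ₈, pairHom_apply, QuarterIso.mul_lin, QuarterIso.pow_lin, QuarterIso.pow_lin,
    Matrix.det_mul, Matrix.det_pow, Matrix.det_pow]
  change B₁.det ^ _ * B₂.det ^ _ = 1
  rw [det_B₁, det_B₂, one_pow, one_pow, one_mul]

theorem not_isOrientable_Γ₈' : ¬ IsOrientable Γ₈' := by
  rw [Γ₈'_eq]
  refine not_isOrientable_crystalGroup φ₈' (x := Multiplicative.ofAdd (1, 0)) ?_
  have h : φ₈' (Multiplicative.ofAdd (1, 0)) = q₁' := by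
    change q₁' ^ 1 * q₂' ^ 0 = q₁'
    simp
  rw [h]
  exact det_B₁'

/-! ### Comparison of the spectra of `Γ` and `Γ'` -/

section Comparison

/-- The matrix with entries `sᵢ` in the positions `(i, σ i)`. -/
def signedPerm {n : ℕ} (σ : Fin n → Fin n) (s : Fin n → ℤ) : Matrix (Fin n) (Fin n) ℤ :=
  Matrix.of fun i j => if j = σ i then s i else 0

theorem extTrace_eq_coeff_detPoly {n p : ℕ} (B : Matrix (Fin n) (Fin n) ℤ) :
    extTrace p B = (((detPoly B).coeff p : ℤ) : ℂ) := extTrace_eq_coeff B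

/-- The exchange of the fourth and fifth coordinates, composed with a translation by `e₄/4`. The
translation makes up for the shift of `q₂'` in the direction of `e₅`, on which `B₂'` acts as `-1`. -/
def exchange : QuarterIso 8 :=
  ⟨signedPerm ![0, 1, 2, 4, 3, 5, 6, 7] 1, by decide +kernel, Pi.single 3 1⟩

theorem q₂_eq : q₂ = q₁' ^ 2 := by
  ext1 <;> decide +kernel

theorem exchange_conj_q₁_sq : exchange * q₁ ^ 2 * exchange⁻¹ = q₂' := by
  rw [mul_inv_eq_iff_eq_mul]
  ext1 <;> decide +kernel

theorem exchange_conj_q₁_sq_q₂ : exchange * (q₁ ^ 2 * q₂) * exchange⁻¹ = q₁' ^ 2 * q₂' := by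
  rw [mul_inv_eq_iff_eq_mul]
  ext1 <;> decide +kernel

variable {p : ℕ}

/-- A matrix that anticommutes with `B` and commutes with `C` anticommutes with `B C` and `B³`. -/
theorem anticommute_mul {n : ℕ} {P B C : Matrix (Fin n) (Fin n) ℤ} (h : P * B = -(B * P))
    (h' : P * C = C * P) : P * (B * C) = -(B * C * P) := by
  rw [← Matrix.mul_assoc, h, Matrix.neg_mul, Matrix.mul_assoc, h', Matrix.mul_assoc]

theorem anticommute_pow_three {n : ℕ} {P B : Matrix (Fin n) (Fin n) ℤ} (h : P * B = -(B * P)) :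
    P * B ^ 3 = -(B ^ 3 * P) := by
  simp only [pow_succ, pow_zero, one_mul]
  rw [← Matrix.mul_assoc, ← Matrix.mul_assoc, h, Matrix.neg_mul, Matrix.mul_assoc B P, h]
  simp only [Matrix.mul_neg, neg_neg, Matrix.mul_assoc, h]

theorem extTrace_odd_of_anticommute (hp : Odd p) {P B C : Matrix (Fin 8) (Fin 8) ℤ}
    (hP : P * Pᵀ = 1) (h : P * B = -(B * P)) (h' : P * C = C * P) :
    extTrace p B = 0 ∧ extTrace p (B * C) = 0 ∧ extTrace p (B ^ 3) = 0 ∧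
      extTrace p (B ^ 3 * C) = 0 :=
  ⟨extTrace_eq_zero_of_odd hp hP h, extTrace_eq_zero_of_odd hp hP (anticommute_mul h h'),
    extTrace_eq_zero_of_odd hp hP (anticommute_pow_three h),
    extTrace_eq_zero_of_odd hp hP (anticommute_mul (anticommute_pow_three h) h')⟩

theorem extTrace_odd_B₁ (hp : Odd p) :
    extTrace p B₁ = 0 ∧ extTrace p (B₁ * B₂) = 0 ∧ extTrace p (B₁ ^ 3) = 0 ∧
      extTrace p (B₁ ^ 3 * B₂) = 0 :=
  extTrace_odd_of_anticommute hp
    (P := signedPerm ![0, 1, 2, 3, 6, 7, 4, 5] ![1, -1, 1, -1, 1, 1, 1, 1])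
    (by decide +kernel) (by decide +kernel) (by decide +kernel)

theorem extTrace_odd_B₁' (hp : Odd p) :
    extTrace p B₁' = 0 ∧ extTrace p (B₁' * B₂') = 0 ∧ extTrace p (B₁' ^ 3) = 0 ∧
      extTrace p (B₁' ^ 3 * B₂') = 0 :=
  extTrace_odd_of_anticommute hp
    (P := signedPerm ![0, 1, 4, 5, 2, 3, 7, 6] ![1, -1, 1, 1, 1, 1, 1, 1])
    (by decide +kernel) (by decide +kernel) (by decide +kernel)

/-- The elements of the point groups other than the odd powers of `q₁` times powers of `q₂` match in
pairs, so that isospectrality depends on the eight remaining elements only. -/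
theorem isospectral_Γ₈_iff : Isospectral Γ₈ Γ₈' p ↔ ∀ μ,
    (phaseSum μ q₁ * extTrace p B₁ + phaseSum μ (q₁ * q₂) * extTrace p (B₁ * B₂)) +
      (phaseSum μ (q₁ ^ 3) * extTrace p (B₁ ^ 3) +
        phaseSum μ (q₁ ^ 3 * q₂) * extTrace p (B₁ ^ 3 * B₂)) =
    (phaseSum μ q₁' * extTrace p B₁' + phaseSum μ (q₁' * q₂') * extTrace p (B₁' * B₂')) +
      (phaseSum μ (q₁' ^ 3) * extTrace p (B₁' ^ 3) +
        phaseSum μ (q₁' ^ 3 * q₂') * extTrace p (B₁' ^ 3 * B₂')) := by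
  rw [Γ₈_eq, Γ₈'_eq, isospectral_iff rfl]
  refine forall_congr' fun μ => ?_
  let T : QuarterIso 8 → ℂ := fun q => LinearMap.trace ℂ _ (coeffPull p μ q)
  have hT : ∀ q, T q = phaseSum μ q * extTrace p q.lin := trace_coeffPull
  have h1 : T q₂ = T (q₁' ^ 2) := by rw [q₂_eq]
  have h2 : T (q₁ ^ 2) = T q₂' := by
    rw [← exchange_conj_q₁_sq]
    exact (trace_coeffPull_conj _ _).symm
  have h3 : T (q₁ ^ 2 * q₂) = T (q₁' ^ 2 * q₂') := by
    rw [← exchange_conj_q₁_sq_q₂]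
    exact (trace_coeffPull_conj _ _).symm
  change ∑ x, T (pairHom q₁ q₂ _ _ _ x) = ∑ x, T (pairHom q₁' q₂' _ _ _ x) ↔ _
  rw [sum_pairHom, sum_pairHom, h1, h2, h3]
  simp only [hT q₁, hT (q₁ * q₂), hT (q₁ ^ 3), hT (q₁ ^ 3 * q₂), hT q₁', hT (q₁' * q₂'),
    hT (q₁' ^ 3), hT (q₁' ^ 3 * q₂'), QuarterIso.mul_lin, QuarterIso.pow_lin]
  change _ = _ ↔ phaseSum μ q₁ * extTrace p q₁.lin +
    phaseSum μ (q₁ * q₂) * extTrace p (q₁.lin * q₂.lin) +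
      (phaseSum μ (q₁ ^ 3) * extTrace p (q₁.lin ^ 3) +
        phaseSum μ (q₁ ^ 3 * q₂) * extTrace p (q₁.lin ^ 3 * q₂.lin)) =
    phaseSum μ q₁' * extTrace p q₁'.lin +
      phaseSum μ (q₁' * q₂') * extTrace p (q₁'.lin * q₂'.lin) +
      (phaseSum μ (q₁' ^ 3) * extTrace p (q₁'.lin ^ 3) +
        phaseSum μ (q₁' ^ 3 * q₂') * extTrace p (q₁'.lin ^ 3 * q₂'.lin))
  constructor
  · intro h
    linear_combination h
  · intro h
    linear_combination h

theorem isospectral_of_odd (hp : Odd p) : Isospectral Γ₈ Γ₈' p := by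
  rw [isospectral_Γ₈_iff]
  intro μ
  obtain ⟨h1, h2, h3, h4⟩ := extTrace_odd_B₁ hp
  obtain ⟨h1', h2', h3', h4'⟩ := extTrace_odd_B₁' hp
  rw [h1, h2, h3, h4, h1', h2', h3', h4']
  simp

/-- The harmonic forms are the invariant forms with constant coefficients. -/
theorem phaseSum_zero {n : ℕ} (q : QuarterIso n) : phaseSum 0 q = 1 := by
  have h0 : (0 : Fin n → ℤ) ∈ frequencies n 0 := by simp [frequencies]
  rw [phaseSum, Fintype.sum_eq_single ⟨0, h0⟩]
  · simp [phase]
  · rintro ⟨m, hm⟩ hne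
    refine absurd (Subtype.ext ?_) hne
    have h1 : 4 * Real.pi ^ 2 * ∑ i, (m i : ℝ) ^ 2 = 0 := hm
    have h2 : ∑ i, (m i : ℝ) ^ 2 = 0 :=
      (mul_eq_zero.1 h1).resolve_left (by positivity)
    rw [Finset.sum_eq_zero_iff_of_nonneg fun i _ => sq_nonneg _] at h2
    funext i
    have h3 := h2 i (Finset.mem_univ i)
    exact_mod_cast pow_eq_zero_iff two_ne_zero |>.1 h3

theorem extTrace_B₁_mul_B₂ : extTrace p (B₁ * B₂) = extTrace p B₁ :=
  extTrace_eq_of_conj (P := signedPerm id ![1, -1, 1, 1, 1, 1, 1, 1])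
    (by decide +kernel) (by decide +kernel)

theorem extTrace_B₁_pow_three : extTrace p (B₁ ^ 3) = extTrace p B₁ :=
  extTrace_eq_of_conj (P := signedPerm id ![1, -1, 1, -1, 1, 1, 1, 1])
    (by decide +kernel) (by decide +kernel)

theorem extTrace_B₁_pow_three_mul_B₂ : extTrace p (B₁ ^ 3 * B₂) = extTrace p B₁ :=
  extTrace_eq_of_conj (P := signedPerm id ![1, 1, 1, -1, 1, 1, 1, 1])
    (by decide +kernel) (by decide +kernel)

theorem extTrace_B₁'_mul_B₂' : extTrace p (B₁' * B₂') = extTrace p B₁' :=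
  extTrace_eq_of_conj (P := signedPerm ![0, 1, 4, 3, 2, 5, 6, 7] ![1, -1, 1, 1, 1, 1, 1, 1])
    (by decide +kernel) (by decide +kernel)

theorem extTrace_B₁'_pow_three : extTrace p (B₁' ^ 3) = extTrace p B₁' :=
  extTrace_eq_of_conj (P := signedPerm id ![1, -1, 1, 1, 1, 1, 1, 1])
    (by decide +kernel) (by decide +kernel)

theorem extTrace_B₁'_pow_three_mul_B₂' : extTrace p (B₁' ^ 3 * B₂') = extTrace p B₁' :=
  extTrace_eq_of_conj (P := signedPerm ![0, 1, 4, 3, 2, 5, 6, 7] 1)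
    (by decide +kernel) (by decide +kernel)

theorem not_isospectral_of_even (hp8 : p ≤ 8) (hp : Even p) (h0 : p ≠ 0) :
    ¬ Isospectral Γ₈ Γ₈' p := by
  rw [isospectral_Γ₈_iff]
  intro h
  have h1 := h 0
  simp only [phaseSum_zero, one_mul, extTrace_B₁_mul_B₂, extTrace_B₁_pow_three,
    extTrace_B₁_pow_three_mul_B₂, extTrace_B₁'_mul_B₂', extTrace_B₁'_pow_three,
    extTrace_B₁'_pow_three_mul_B₂'] at h1
  have h2 : extTrace p B₁ = extTrace p B₁' := by linear_combination h1 / 4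
  rw [extTrace_eq_coeff_detPoly, extTrace_eq_coeff_detPoly] at h2
  exact coeff_detPoly_ne hp8 hp h0 (by exact_mod_cast h2)

/-! ### Functions: the first nonzero eigenvalue of the torus -/

/-- The integer `iˢ + i⁻ˢ`. -/
def charSum (s : ZMod 4) : ℤ := if s = 0 then 2 else if s = 2 then -2 else 0

theorem stdAddChar_add_stdAddChar_neg (s : ZMod 4) :
    (ZMod.stdAddChar s + ZMod.stdAddChar (-s) : ℂ) = charSum s := by
  have h0 : (ZMod.stdAddChar (0 : ZMod 4) : ℂ) = 1 := AddChar.map_zero_eq_one _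
  have h1 : (ZMod.stdAddChar (1 : ZMod 4) : ℂ) = Complex.I := by
    have := ZMod.stdAddChar_coe (N := 4) 1
    rw [Int.cast_one] at this
    rw [this]
    refine Eq.trans ?_ Complex.exp_pi_div_two_mul_I
    congr 1
    push_cast
    ring
  have h2 : (ZMod.stdAddChar (2 : ZMod 4) : ℂ) = -1 := by
    rw [show (2 : ZMod 4) = 1 + 1 by decide, AddChar.map_add_eq_mul, h1, Complex.I_mul_I]
  have h3 : (ZMod.stdAddChar (3 : ZMod 4) : ℂ) = -Complex.I := by
    rw [show (3 : ZMod 4) = 2 + 1 by decide, AddChar.map_add_eq_mul, h1, h2, neg_one_mul]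
  fin_cases s
  · change (ZMod.stdAddChar (0 : ZMod 4) + ZMod.stdAddChar (0 : ZMod 4) : ℂ) = (2 : ℤ)
    rw [h0]
    norm_num
  · change (ZMod.stdAddChar (1 : ZMod 4) + ZMod.stdAddChar (3 : ZMod 4) : ℂ) = (0 : ℤ)
    rw [h1, h3]
    simp
  · change (ZMod.stdAddChar (2 : ZMod 4) + ZMod.stdAddChar (2 : ZMod 4) : ℂ) = (-2 : ℤ)
    rw [h2]
    norm_num
  · change (ZMod.stdAddChar (3 : ZMod 4) + ZMod.stdAddChar (1 : ZMod 4) : ℂ) = (0 : ℤ)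
    rw [h1, h3]
    simp

theorem mem_frequencies_one_iff {n : ℕ} {m : Fin n → ℤ} :
    m ∈ frequencies n (4 * Real.pi ^ 2) ↔ ∑ i, m i ^ 2 = 1 := by
  have h : (4 * Real.pi ^ 2 : ℝ) ≠ 0 := by positivity
  change 4 * Real.pi ^ 2 * ∑ i, (m i : ℝ) ^ 2 = 4 * Real.pi ^ 2 ↔ _
  rw [mul_eq_left₀ h]
  exact_mod_cast Iff.rfl

/-- The frequencies of the first nonzero eigenvalue of the torus are the vectors `± eᵢ`. -/
theorem bijective_unitFreq (n : ℕ) : Function.Bijective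
    fun x : Fin n × ℤˣ => (⟨Pi.single x.1 (x.2 : ℤ), mem_frequencies_one_iff.2 (by
      rw [Finset.sum_eq_single x.1 (fun j _ hj => by simp [hj]) (by simp)]
      simp [← Units.val_pow_eq_pow_val, Int.units_sq])⟩ : frequencies n (4 * Real.pi ^ 2)) := by
  constructor
  · rintro ⟨i, u⟩ ⟨j, v⟩ h
    have h1 := congrFun (congrArg Subtype.val h) i
    simp only [Pi.single_eq_same] at h1
    by_cases hij : i = j
    · subst hij
      simp only [Pi.single_eq_same] at h1
      rw [Units.ext h1]
    · rw [Pi.single_eq_of_ne hij] at h1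
      exact absurd h1 u.ne_zero
  · rintro ⟨m, hm⟩
    have h1 := mem_frequencies_one_iff.1 hm
    obtain ⟨i, hi⟩ : ∃ i, m i ≠ 0 := by
      by_contra! hz
      simp [hz] at h1
    have h2 := Finset.add_sum_erase Finset.univ (fun i => m i ^ 2) (Finset.mem_univ i)
    have h3 : 0 < m i ^ 2 := by positivity
    have h4 : 0 ≤ ∑ j ∈ Finset.univ.erase i, m j ^ 2 := Finset.sum_nonneg fun j _ => sq_nonneg _
    simp only [h1] at h2
    have h5 : ∑ j ∈ Finset.univ.erase i, m j ^ 2 = 0 := by omega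
    rw [Finset.sum_eq_zero_iff_of_nonneg fun i _ => sq_nonneg _] at h5
    have h6 : m i ^ 2 = 1 := by omega
    refine ⟨⟨i, Units.mkOfMulEqOne (m i) (m i) (by rw [← sq, h6])⟩, Subtype.ext ?_⟩
    funext j
    by_cases hj : j = i
    · subst hj
      simp
    · have := h5 j (by simp [hj])
      simp [hj, pow_eq_zero_iff two_ne_zero |>.1 this]

/-- The sum of the phases of `q` over the vectors `± eᵢ` fixed by the linear part. -/
def unitPhaseSum (q : QuarterIso 8) : ℤ :=
  ∑ i, if q.lin *ᵥ Pi.single i 1 = Pi.single i 1 then charSum (q.shift i) else 0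

theorem phase_single {n : ℕ} (q : QuarterIso n) (i : Fin n) (k : ℤ) :
    phase q (Pi.single i k) = ZMod.stdAddChar ((k : ZMod 4) * q.shift i) := by
  rw [phase, Finset.sum_eq_single i (fun j _ hj => by simp [hj]) (by simp)]
  simp

theorem phaseSum_one (q : QuarterIso 8) : phaseSum (4 * Real.pi ^ 2) q = unitPhaseSum q := by
  rw [phaseSum, ← (Equiv.ofBijective _ (bijective_unitFreq 8)).sum_comp, Fintype.sum_prod_type,
    unitPhaseSum, Int.cast_sum]
  refine Finset.sum_congr rfl fun i _ => ?_
  simp only [Equiv.ofBijective_apply]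
  rw [UnitsInt.univ, Finset.sum_pair (by decide)]
  have h1 : ((1 : ℤˣ) : ℤ) = 1 := rfl
  have h2 : ((-1 : ℤˣ) : ℤ) = -1 := rfl
  have h3 : (Pi.single i (-1) : Fin 8 → ℤ) = -Pi.single i 1 := by
    rw [Pi.single_neg]
  rw [h1, h2, phase_single, phase_single]
  simp only [h3, Matrix.mulVec_neg, neg_inj]
  split_ifs
  · rw [← stdAddChar_add_stdAddChar_neg]
    simp
  · simp

theorem extTrace_zero {n : ℕ} (B : Matrix (Fin n) (Fin n) ℤ) : extTrace 0 B = 1 := by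
  rw [extTrace_eq_coeff_detPoly, coeff_zero_detPoly, Int.cast_one]

theorem not_isospectral_zero : ¬ Isospectral Γ₈ Γ₈' 0 := by
  rw [isospectral_Γ₈_iff]
  intro h
  have h1 := h (4 * Real.pi ^ 2)
  simp only [extTrace_zero, mul_one, phaseSum_one] at h1
  have h2 : (unitPhaseSum q₁ + unitPhaseSum (q₁ * q₂)) +
      (unitPhaseSum (q₁ ^ 3) + unitPhaseSum (q₁ ^ 3 * q₂)) =
      (unitPhaseSum q₁' + unitPhaseSum (q₁' * q₂')) +
      (unitPhaseSum (q₁' ^ 3) + unitPhaseSum (q₁' ^ 3 * q₂')) := by exact_mod_cast h1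
  revert h2
  decide +kernel

theorem isospectral_Γ₈_iff_odd (hp : p ≤ 8) : Isospectral Γ₈ Γ₈' p ↔ Odd p := by
  refine ⟨fun h => ?_, isospectral_of_odd⟩
  by_contra hodd
  rw [Nat.not_odd_iff_even] at hodd
  rcases eq_or_ne p 0 with rfl | h0
  · exact not_isospectral_zero h
  · exact not_isospectral_of_even hp hodd h0 h

end Comparison

end FlatForms

end

theorem mainTheorem5 :
    (FlatForms.IsBieberbach FlatForms.Γ₈ ∧ FlatForms.IsBieberbach FlatForms.Γ₈') ∧
    (Nonempty (FlatForms.holonomy FlatForms.Γ₈ ≃* Multiplicative (ZMod 4 × ZMod 2)) ∧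
      Nonempty (FlatForms.holonomy FlatForms.Γ₈' ≃* Multiplicative (ZMod 4 × ZMod 2))) ∧
    (FlatForms.IsOrientable FlatForms.Γ₈ ∧ ¬ FlatForms.IsOrientable FlatForms.Γ₈') ∧
    (∀ p : ℕ, p ≤ 8 → (FlatForms.Isospectral FlatForms.Γ₈ FlatForms.Γ₈' p ↔ Odd p)) := by
  refine ⟨⟨?_, ?_⟩, ⟨?_, ?_⟩, ⟨FlatForms.isOrientable_Γ₈, FlatForms.not_isOrientable_Γ₈'⟩,
    fun p hp => FlatForms.isospectral_Γ₈_iff_odd hp⟩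
  · rw [FlatForms.Γ₈_eq]
    exact FlatForms.isBieberbach_crystalGroup _ FlatForms.φ₈_moves
  · rw [FlatForms.Γ₈'_eq]
    exact FlatForms.isBieberbach_crystalGroup _ FlatForms.φ₈'_moves
  · rw [FlatForms.Γ₈_eq]
    exact FlatForms.nonempty_holonomy_mulEquiv _ FlatForms.φ₈_faithful
  · rw [FlatForms.Γ₈'_eq]
    exact FlatForms.nonempty_holonomy_mulEquiv _ FlatForms.φ₈'_faithful
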